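/- Conventions. A tangent manifold $(M^{2n},S)$ is a smooth manifold with a smooth field $S$ of endomorphisms of $TM$ with $S^2=0$, $\operatorname{im}S=\ker S$, such that around every point there are coordinates $(x^i,y^i)_{i=1}^n$ with $S(\partial/\partial x^i)=\partial/\partial y^i$, $S(\partial/\partial y^i)=0$. Its vertical foliation $\mathcal V$ has tangent bundle $T\mathcal V=\operatorname{im}S$. A foliated function is a smooth function annihilated by vertical vectors; a foliated vector field is one which maps (local) foliated functions to foliated functions. For a function $L$ on an open set put $\theta_L(X)=(SX)L$ and $(\operatorname{Hess}L)_x(X_1,X_2)=(S\tilde X_2)(S\tilde X_1)L|_x$, with $\tilde X_i$ local foliated extensions of $X_i$. A locally Lagrange space $(M,S,g,\{L_\alpha\})$ is a tangent manifold with a symmetric tensor field $g$ of type $(0,2)$, annihilated by $\operatorname{im}S$ and non-degenerate on $TM/T\mathcal V$, and with an open covering $M=\bigcup_\alpha U_\alpha$ and smooth functions $L_\alpha$ on $U_\alpha$ such that $g|_{U_\alpha}=\operatorname{Hess}L_\alpha$ for all $\alpha$. Let $\underline A^0$ be the sheaf of leafwise affine functions (smooth $f$ such that $(SX)f$ is foliated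 for all local foliated $X$; locally $f=\sum_i\alpha_i(x)y^i+\beta(x)$), let $\underline\Omega^{(1,0)}_{pr}$ be the sheaf of foliated 1-forms of type $(1,0)$ (locally $\sum_i\xi_i(x)\,dx^i$), and let $\pi':\underline A^0\to\underline\Omega^{(1,0)}_{pr}$, $f\mapsto df\circ S$ (locally $\sum_i\alpha_i y^i+\beta\mapsto\sum_i\alpha_i\,dx^i$). The functions $L_\beta-L_\alpha$ form a 1-cocycle with values in $\underline A^0$; let $\mathcal G\in H^1(M,\underline A^0)$ be its Čech cohomology class. The first Lagrangian obstruction is $\mathcal G_1=\pi'^*(\mathcal G)\in H^1(M,\underline\Omega^{(1,0)}_{pr})$. A normal bundle $N\mathcal V$ is a smooth distribution with $TM=N\mathcal V\oplus T\mathcal V$. It gives a bigrading of differential forms (type $(p,q)$: $p$ normal and $q$ vertical arguments), and $d''$ is the part of bidegree $(0,1)$ of the exterior derivative. A form is $d''$-exact if it equals $d''\mu$ for some smooth form $\mu$ on $M$. **Proposition.** Let $(M,S,g,\{L_\alpha\})$ be a locally Lagrange space and let $N\mathcal V$ be a normal bundle. Then the forms $d''\theta_{L_\alpha}$ agree on the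 intersections $U_\alpha\cap U_\beta$ and glue to a global smooth 2-form $\Theta$ on $M$ with $\Theta|_{U_\alpha}=d''\theta_{L_\alpha}$ for all $\alpha$. The form $\Theta$ is of type $(1,1)$, it is non-degenerate (hence an almost symplectic structure on $M$), and $d''\Theta=0$. Moreover, $\mathcal G_1=0$ if and only if $\Theta$ is $d''$-exact. -/

import Mathlib

open scoped Manifold ContDiff Topology

namespace LocLagrange

universe u w

noncomputable section

/-! ### Čech cohomology in degree one -/

section Cech

open CategoryTheory Opposite TopologicalSpace

variable {X : Type u} [TopologicalSpace X]

/-- Presheaves of abelian groups on a topological space. -/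
abbrev AbPresheaf (X : Type u) [TopologicalSpace X] := (Opens X)ᵒᵖ ⥤ AddCommGrpCat.{u}

/-- Restriction of sections. -/
def res (F : AbPresheaf X) {U V : Opens X} (h : V ≤ U) : F.obj (op U) →+ F.obj (op V) :=
  (F.map (homOfLE h).op).hom

theorem res_res (F : AbPresheaf X) {U V W : Opens X} (h : V ≤ U) (k : W ≤ V) (s : F.obj (op U)) :
    res F k (res F h s) = res F (k.trans h) s := by
  have := F.map_comp (homOfLE h).op (homOfLE k).op
  exact (congrArg (fun f => f.hom s) this).symm

theorem res_naturality {F G : AbPresheaf X} (η : F ⟶ G) {U V : Opens X} (h : V ≤ U)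
    (s : F.obj (op U)) : (η.app (op V)).hom (res F h s) = res G h ((η.app (op U)).hom s) :=
  congrArg (fun f => f.hom s) (η.naturality (homOfLE h).op)

/-- Čech 1-cocycles of a family of open sets: `c_{jk} - c_{ik} + c_{ij} = 0` on triple
intersections. -/
def Z1 (F : AbPresheaf X) {ι : Type w} (U : ι → Opens X) :
    AddSubgroup (∀ i j, F.obj (op (U i ⊓ U j))) where
  carrier := {c | ∀ i j k,
    res F (U := U j ⊓ U k) (V := U i ⊓ U j ⊓ U k)
        (le_inf (inf_le_left.trans inf_le_right) inf_le_right) (c j k)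
      - res F (U := U i ⊓ U k) (le_inf (inf_le_left.trans inf_le_left) inf_le_right) (c i k)
      + res F (U := U i ⊓ U j) inf_le_left (c i j) = 0}
  zero_mem' := by intro i j k; simp
  add_mem' := by
    intro a b ha hb i j k
    have h1 := ha i j k
    have h2 := hb i j k
    simp only [Pi.add_apply, map_add]
    rw [← add_zero (0 : F.obj (op (U i ⊓ U j ⊓ U k)))]
    nth_rewrite 1 [← h1]
    rw [← h2]
    abel
  neg_mem' := by
    intro a ha i j k
    have h1 := ha i j k
    simp only [Pi.neg_apply, map_neg]
    rw [← neg_zero, ← h1]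
    abel

/-- The Čech coboundary of a 0-cochain: `(δb)_{ij} = b_j - b_i`. -/
def delta0 (F : AbPresheaf X) {ι : Type w} (U : ι → Opens X) :
    (∀ i, F.obj (op (U i))) →+ Z1 F U where
  toFun b := ⟨fun i j => res F inf_le_right (b j) - res F inf_le_left (b i), by
    intro i j k
    simp only [map_sub, res_res]
    abel⟩
  map_zero' := by
    ext i j
    simp
  map_add' a b := by
    apply Subtype.ext
    funext i j
    simp only [Pi.add_apply, map_add, AddSubgroup.coe_add]
    abel

/-- First Čech cohomology of a family of open sets. -/
abbrev CoverH1 (F : AbPresheaf X) {ι : Type w} (U : ι → Opens X) : Type _ :=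
  Z1 F U ⧸ (delta0 F U).range

/-- Pull-back of cocycles along a refinement. -/
def refineZ1 (F : AbPresheaf X) {ι κ : Type*} {U : ι → Opens X} {V : κ → Opens X} (τ : κ → ι)
    (h : ∀ k, V k ≤ U (τ k)) : Z1 F U →+ Z1 F V where
  toFun c := ⟨fun i j => res F (inf_le_inf (h i) (h j)) (c.1 (τ i) (τ j)), by
    intro i j k
    have := congrArg (res F (inf_le_inf (inf_le_inf (h i) (h j)) (h k))) (c.2 (τ i) (τ j) (τ k))
    simpa only [map_sub, map_add, map_zero, res_res] using this⟩
  map_zero' := by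
    apply Subtype.ext
    funext i j
    simp
  map_add' a b := by
    apply Subtype.ext
    funext i j
    simp

/-- The map induced by a refinement on the cohomology of families of open sets. -/
def refineH1 (F : AbPresheaf X) {ι κ : Type*} {U : ι → Opens X} {V : κ → Opens X} (τ : κ → ι)
    (h : ∀ k, V k ≤ U (τ k)) : CoverH1 F U →+ CoverH1 F V :=
  QuotientAddGroup.map _ _ (refineZ1 F τ h) (by
    rintro _ ⟨b, rfl⟩
    refine ⟨fun k => res F (h k) (b (τ k)), ?_⟩
    apply Subtype.ext
    funext i j
    simp [delta0, refineZ1, res_res])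

/-- Open coverings indexed by the points of the space, `x ∈ U x`; every open covering has a
refinement of this form. -/
def PointCover (X : Type u) [TopologicalSpace X] := {U : X → Opens X // ∀ x, x ∈ U x}

/-- `U ≤ V` if `V` is finer than `U`, point by point. -/
instance : Preorder (PointCover X) where
  le U V := ∀ x, V.1 x ≤ U.1 x
  le_refl _ _ := le_rfl
  le_trans _ _ _ h k x := (k x).trans (h x)

open Classical in
/-- The first Čech cohomology group of a space: the direct limit over the open coverings. -/
def H1 (F : AbPresheaf X) : Type u :=
  AddCommGroup.DirectLimit (fun U : PointCover X => CoverH1 F U.1)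
    (fun _ _ h => refineH1 F id h)

open Classical in
instance (F : AbPresheaf X) : AddCommGroup (H1 F) :=
  inferInstanceAs (AddCommGroup (AddCommGroup.DirectLimit
    (fun U : PointCover X => CoverH1 F U.1) (fun _ _ h => refineH1 F id h)))

open Classical in
/-- The class in `H¹(X, F)` of a cohomology class of a point-indexed covering. -/
def ofPointCover (F : AbPresheaf X) (U : PointCover X) : CoverH1 F U.1 →+ H1 F :=
  AddCommGroup.DirectLimit.of (fun U : PointCover X => CoverH1 F U.1)
    (fun _ _ h => refineH1 F id h) U

/-- The canonical homomorphism from the cohomology of an open covering to `H¹(X, F)`. -/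
def ofCover (F : AbPresheaf X) {ι : Type w} (U : ι → Opens X) (hU : ∀ x, ∃ i, x ∈ U i) :
    CoverH1 F U →+ H1 F :=
  (ofPointCover F ⟨fun x => U (hU x).choose, fun x => (hU x).choose_spec⟩).comp
    (refineH1 F (fun x => (hU x).choose) (fun _ => le_rfl))

/-- The map on cocycles induced by a homomorphism of presheaves. -/
def mapZ1 {F G : AbPresheaf X} (η : F ⟶ G) {ι : Type w} (U : ι → Opens X) : Z1 F U →+ Z1 G U where
  toFun c := ⟨fun i j => (η.app _).hom (c.1 i j), by
    intro i j k
    have := congrArg (η.app (op (U i ⊓ U j ⊓ U k))).hom (c.2 i j k)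
    simpa only [map_sub, map_add, map_zero, res_naturality] using this⟩
  map_zero' := by
    apply Subtype.ext
    funext i j
    simp
  map_add' a b := by
    apply Subtype.ext
    funext i j
    simp

/-- The map on the cohomology of a covering induced by a homomorphism of presheaves. -/
def mapCoverH1 {F G : AbPresheaf X} (η : F ⟶ G) {ι : Type w} (U : ι → Opens X) :
    CoverH1 F U →+ CoverH1 G U :=
  QuotientAddGroup.map _ _ (mapZ1 η U) (by
    rintro _ ⟨b, rfl⟩
    refine ⟨fun i => (η.app _).hom (b i), ?_⟩
    apply Subtype.ext
    funext i j
    simp [delta0, mapZ1, res_naturality])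

open Classical in
/-- The map `η^* : H¹(X, F) → H¹(X, G)` induced by a homomorphism of presheaves. -/
def mapH1 {F G : AbPresheaf X} (η : F ⟶ G) : H1 F →+ H1 G :=
  AddCommGroup.DirectLimit.map (fun U : PointCover X => mapCoverH1 η U.1) (by
    intro U V h
    ext c
    refine congrArg (QuotientAddGroup.mk (s := (delta0 G V.1).range)) ?_
    apply Subtype.ext
    funext i j
    exact res_naturality η _ _)

/-- A class of sections, over the open sets, of a family of abelian groups `E x`, that is closed
under the group operations and under restriction. Here a section over `U` is given by a
section defined everywhere of which only the values on `U` count. -/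
structure LocalClass (E : X → Type) [∀ x, AddCommGroup (E x)] where
  Mem : Opens X → (∀ x, E x) → Prop
  zero_mem : ∀ U, Mem U 0
  add_mem : ∀ U s t, Mem U s → Mem U t → Mem U (s + t)
  neg_mem : ∀ U s, Mem U s → Mem U (-s)
  mono : ∀ U V, V ≤ U → ∀ s, Mem U s → Mem V s
  congr : ∀ U s t, (∀ x ∈ U, s x = t x) → Mem U s → Mem U t

variable {E : X → Type} [∀ x, AddCommGroup (E x)]

open Classical in
/-- Extension by zero of a section over `U`. -/
def extZero (U : Opens X) (s : ∀ x : U, E x) : ∀ x, E x :=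
  fun x => if h : x ∈ U then s ⟨x, h⟩ else 0

theorem extZero_apply {U : Opens X} (s : ∀ x : U, E x) {x : X} (h : x ∈ U) :
    extZero U s x = s ⟨x, h⟩ := by
  simp [extZero, h]

/-- The sections over `U`, as a group of functions on `U`. -/
def LocalClass.sections (C : LocalClass E) (U : Opens X) : AddSubgroup (∀ x : U, E x) where
  carrier := {s | C.Mem U (extZero U s)}
  zero_mem' := C.congr U 0 _ (fun x hx => by rw [extZero_apply _ hx]; rfl) (C.zero_mem U)
  add_mem' := fun {a b} ha hb => C.congr U _ _
    (fun x hx => by simp [extZero_apply _ hx]) (C.add_mem U _ _ ha hb)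
  neg_mem' := fun {a} ha => C.congr U _ _
    (fun x hx => by simp [extZero_apply _ hx]) (C.neg_mem U _ ha)

/-- Restriction of sections to a smaller open set. -/
def LocalClass.restrict (C : LocalClass E) {U V : Opens X} (h : V ≤ U) :
    C.sections U →+ C.sections V where
  toFun s := ⟨fun x => s.1 ⟨x.1, h x.2⟩, C.congr V _ _
    (fun x hx => by rw [extZero_apply _ hx, extZero_apply _ (h hx)]) (C.mono U V h _ s.2)⟩
  map_zero' := rfl
  map_add' _ _ := rfl

/-- The presheaf of sections. -/
def LocalClass.presheaf (C : LocalClass E) : AbPresheaf X where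
  obj U := AddCommGrpCat.of (C.sections U.unop)
  map f := AddCommGrpCat.ofHom (C.restrict (leOfHom f.unop))

/-- The section over `U` given by a section defined everywhere. -/
def LocalClass.toSection (C : LocalClass E) (U : Opens X) (s : ∀ x, E x) (hs : C.Mem U s) :
    C.presheaf.obj (op U) :=
  ⟨fun x => s x, C.congr U _ _ (fun x hx => by rw [extZero_apply _ hx]) hs⟩

/-- A local additive operator that respects the classes of sections gives a homomorphism of
presheaves. -/
def LocalClass.hom {E' : X → Type} [∀ x, AddCommGroup (E' x)] (C : LocalClass E)
    (C' : LocalClass E') (T : (∀ x, E x) → (∀ x, E' x))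
    (hadd : ∀ U s t, C.Mem U s → C.Mem U t → ∀ x ∈ U, T (s + t) x = T s x + T t x)
    (hcongr : ∀ (U : Opens X) s t, (∀ x ∈ U, s x = t x) → ∀ x ∈ U, T s x = T t x)
    (hmem : ∀ U s, C.Mem U s → C'.Mem U (T s)) : C.presheaf ⟶ C'.presheaf where
  app U := AddCommGrpCat.ofHom (AddMonoidHom.mk'
    (fun s : C.sections U.unop => (⟨fun x => T (extZero U.unop s.1) x,
      C'.congr _ _ _ (fun x hx => by rw [extZero_apply _ hx]) (hmem _ _ s.2)⟩ :
        C'.sections U.unop)) (by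
      intro s t
      apply Subtype.ext
      funext x
      refine (hcongr U.unop _ (extZero U.unop s.1 + extZero U.unop t.1) ?_ x.1 x.2).trans
        (hadd U.unop _ _ s.2 t.2 x.1 x.2)
      intro y hy
      simp [extZero_apply _ hy]))
  naturality U V f := by
    ext s
    apply Subtype.ext
    funext x
    refine hcongr V.unop _ _ ?_ x.1 x.2
    intro y hy
    have hy' : y ∈ U.unop := leOfHom f.unop hy
    rw [extZero_apply _ hy]
    exact (extZero_apply (s : C.sections U.unop).1 hy').symm

end Cech

/-! ### Differential forms on a manifold of dimension `2n` -/

section Forms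

open Bundle

/-- The model space `ℝ²ⁿ`. -/
abbrev Model (n : ℕ) := EuclideanSpace ℝ (Fin (2 * n))

variable {n : ℕ} {M : Type u} [TopologicalSpace M] [ChartedSpace (Model n) M]

/-- The tangent space at a point of a manifold of dimension `2n`. -/
abbrev Tan (n : ℕ) {M : Type u} [TopologicalSpace M] [ChartedSpace (Model n) M] (x : M) : Type :=
  TangentSpace (𝓡 (2 * n)) x

/-- (Not necessarily smooth) differential `k`-forms. -/
abbrev Form (n : ℕ) (M : Type u) [TopologicalSpace M] [ChartedSpace (Model n) M] (k : ℕ) :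
    Type u :=
  ∀ x : M, (Tan n x) [⋀^Fin k]→L[ℝ] ℝ

/-- The expression of a form in the chart at `x₀`: its pull-back by the inverse of the chart. -/
def Form.inChart {k : ℕ} (η : Form n M k) (x₀ : M) (e : Model n) :
    (Model n) [⋀^Fin k]→L[ℝ] ℝ :=
  (η ((chartAt (Model n) x₀).symm e)).compContinuousLinearMap
    (mfderiv 𝓘(ℝ, Model n) (𝓡 (2 * n)) (chartAt (Model n) x₀).symm e)

/-- Smoothness of a form on a set. -/
def Form.SmoothOn {k : ℕ} (η : Form n M k) (U : Set M) : Prop :=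
  ∀ x ∈ U, ContDiffAt ℝ ∞ (η.inChart x) (chartAt (Model n) x x)

/-- Smoothness of a form. -/
def Form.Smooth {k : ℕ} (η : Form n M k) : Prop := η.SmoothOn Set.univ

/-- The exterior derivative, computed at `x` in the chart at `x`. -/
def Form.d {k : ℕ} (η : Form n M k) : Form n M (k + 1) := fun x =>
  (extDeriv (η.inChart x) (chartAt (Model n) x x)).compContinuousLinearMap
    (mfderiv (𝓡 (2 * n)) 𝓘(ℝ, Model n) (chartAt (Model n) x) x)

/-- A field of linear functionals as a 1-form. -/
def oneForm (a : ∀ x : M, Tan n x →L[ℝ] ℝ) : Form n M 1 := fun x =>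
  ContinuousAlternatingMap.ofSubsingleton ℝ (Tan n x) ℝ (0 : Fin 1) (a x)

/-- Non-degeneracy of a 2-form. -/
def Form.Nondegenerate (η : Form n M 2) : Prop :=
  ∀ (x : M) (v : Tan n x), (∀ w : Tan n x, η x ![v, w] = 0) → v = 0

/-- An almost symplectic structure is a smooth non-degenerate 2-form. -/
def IsAlmostSymplectic (η : Form n M 2) : Prop := η.Smooth ∧ η.Nondegenerate

/-- A vector field, smooth on a set. -/
def VFSmoothOn [IsManifold (𝓡 (2 * n)) ∞ M] (X : ∀ x : M, Tan n x) (U : Set M) : Prop :=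
  ContMDiffOn (𝓡 (2 * n)) (𝓡 (2 * n)).tangent ∞
    (fun x => (⟨x, X x⟩ : TangentBundle (𝓡 (2 * n)) M)) U

/-- The differential of a function at a point, as a linear functional. -/
def diff (f : M → ℝ) (x : M) : Tan n x →L[ℝ] ℝ := mfderiv (𝓡 (2 * n)) 𝓘(ℝ, ℝ) f x

/-- The derivative `X f` of a function in the direction of a vector field. -/
def dirDeriv (X : ∀ x : M, Tan n x) (f : M → ℝ) : M → ℝ := fun x => diff f x (X x)

/-! Elementary facts on these notions. -/

open Filter TopologicalSpace

theorem mdiff_of_smoothOn {W : Opens M} {f : M → ℝ}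
    (hf : ContMDiffOn (𝓡 (2 * n)) 𝓘(ℝ, ℝ) ∞ f W) {x : M} (hx : x ∈ W) :
    MDifferentiableAt (𝓡 (2 * n)) 𝓘(ℝ, ℝ) f x :=
  (hf.contMDiffAt (W.isOpen.mem_nhds hx)).mdifferentiableAt (by simp)

theorem diff_congr_on {W : Opens M} {f f' : M → ℝ} (h : ∀ x ∈ W, f x = f' x) {x : M}
    (hx : x ∈ W) : diff (n := n) f x = diff f' x := by
  have : f =ᶠ[𝓝 x] f' := by
    filter_upwards [W.isOpen.mem_nhds hx] with y hy using h y hy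
  exact this.mfderiv_eq

theorem diff_add {W : Opens M} {f f' : M → ℝ}
    (hf : ContMDiffOn (𝓡 (2 * n)) 𝓘(ℝ, ℝ) ∞ f W) (hf' : ContMDiffOn (𝓡 (2 * n)) 𝓘(ℝ, ℝ) ∞ f' W)
    {x : M} (hx : x ∈ W) : diff (n := n) (f + f') x = diff f x + diff f' x :=
  mfderiv_add (mdiff_of_smoothOn hf hx) (mdiff_of_smoothOn hf' hx)

theorem diff_neg (f : M → ℝ) (x : M) : diff (n := n) (-f) x = -diff f x :=
  mfderiv_neg

theorem diff_zero (x : M) : diff (n := n) (0 : M → ℝ) x = 0 :=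
  mfderiv_const

theorem dirDeriv_congr_on {W : Opens M} {f f' : M → ℝ} (h : ∀ x ∈ W, f x = f' x)
    (X : ∀ x : M, Tan n x) : ∀ x ∈ W, dirDeriv X f x = dirDeriv X f' x := by
  intro x hx
  rw [dirDeriv, dirDeriv, diff_congr_on h hx]

theorem dirDeriv_add {W : Opens M} {f f' : M → ℝ}
    (hf : ContMDiffOn (𝓡 (2 * n)) 𝓘(ℝ, ℝ) ∞ f W) (hf' : ContMDiffOn (𝓡 (2 * n)) 𝓘(ℝ, ℝ) ∞ f' W)
    (X : ∀ x : M, Tan n x) : ∀ x ∈ W, dirDeriv X (f + f') x = (dirDeriv X f + dirDeriv X f') x := by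
  intro x hx
  rw [dirDeriv, diff_add hf hf' hx]
  rfl

theorem dirDeriv_neg (f : M → ℝ) (X : ∀ x : M, Tan n x) : dirDeriv X (-f) = -dirDeriv X f := by
  funext x
  rw [dirDeriv, diff_neg]
  rfl

theorem dirDeriv_zero (X : ∀ x : M, Tan n x) : dirDeriv X (0 : M → ℝ) = 0 := by
  funext x
  rw [dirDeriv, diff_zero]
  rfl

/-- Additivity of the chart expression. -/
theorem inChart_add {k : ℕ} (ξ ζ : Form n M k) (x₀ : M) :
    Form.inChart (ξ + ζ : Form n M k) x₀ = ξ.inChart x₀ + ζ.inChart x₀ := by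
  funext e
  ext v
  rfl

theorem inChart_neg {k : ℕ} (ξ : Form n M k) (x₀ : M) :
    Form.inChart (-ξ : Form n M k) x₀ = -ξ.inChart x₀ := by
  funext e
  ext v
  rfl

theorem inChart_zero {k : ℕ} (x₀ : M) : Form.inChart (0 : Form n M k) x₀ = 0 := by
  funext e
  ext v
  rfl

theorem inChart_congr {k : ℕ} {W : Opens M} {ξ ζ : Form n M k} (h : ∀ x ∈ W, ξ x = ζ x) {x : M}
    (hx : x ∈ W) : ξ.inChart x =ᶠ[𝓝 (chartAt (Model n) x x)] ζ.inChart x := by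
  have hc := (chartAt (Model n) x).continuousAt_symm (mem_chart_target (Model n) x)
  have hm : (W : Set M) ∈ 𝓝 ((chartAt (Model n) x).symm (chartAt (Model n) x x)) := by
    rw [(chartAt (Model n) x).left_inv (mem_chart_source _ x)]
    exact W.isOpen.mem_nhds hx
  filter_upwards [hc.preimage_mem_nhds hm] with e he
  simp only [Form.inChart]
  rw [h _ he]

/-- Smoothness of a field of endomorphisms of the tangent spaces. -/
def EndoSmooth [IsManifold (𝓡 (2 * n)) ∞ M] (P : ∀ x : M, Tan n x →L[ℝ] Tan n x) : Prop :=
  ContMDiff (𝓡 (2 * n)) ((𝓡 (2 * n)).prod 𝓘(ℝ, Model n →L[ℝ] Model n)) ∞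
    (fun x => TotalSpace.mk' (Model n →L[ℝ] Model n)
      (E := fun x : M => Tan n x →L[ℝ] Tan n x) x (P x))

/-- Smoothness of a field of bilinear forms on the tangent spaces. -/
def BilinSmooth [IsManifold (𝓡 (2 * n)) ∞ M] (g : ∀ x : M, Tan n x →L[ℝ] Tan n x →L[ℝ] ℝ) :
    Prop :=
  ContMDiff (𝓡 (2 * n)) ((𝓡 (2 * n)).prod 𝓘(ℝ, Model n →L[ℝ] Model n →L[ℝ] ℝ)) ∞
    (fun x => TotalSpace.mk' (Model n →L[ℝ] Model n →L[ℝ] ℝ)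
      (E := fun x : M => Tan n x →L[ℝ] Tan n x →L[ℝ] ℝ) x (g x))

end Forms

/-! ### Tangent manifolds, foliated objects, normal bundles -/

section Tangent

open TopologicalSpace

variable {n : ℕ} {M : Type u} [TopologicalSpace M] [ChartedSpace (Model n) M]
  [IsManifold (𝓡 (2 * n)) ∞ M]

/-- A tangent structure: a smooth field of endomorphisms `S` of the tangent spaces with `S² = 0`
and `im S = ker S`, which is integrable: around every point there are local coordinates
`(x, y) = e ∘ φ` with `S (∂/∂xⁱ) = ∂/∂yⁱ` and `S (∂/∂yⁱ) = 0`. -/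
structure TangentStructure (n : ℕ) (M : Type u) [TopologicalSpace M] [ChartedSpace (Model n) M]
    [IsManifold (𝓡 (2 * n)) ∞ M] where
  endo : ∀ x : M, Tan n x →L[ℝ] Tan n x
  smooth : EndoSmooth endo
  sq_eq_zero : ∀ (x : M) (v : Tan n x), endo x (endo x v) = 0
  range_eq_ker : ∀ x : M, (endo x).range = (endo x).ker
  integrable : ∀ x : M, ∃ φ ∈ IsManifold.maximalAtlas (𝓡 (2 * n)) ∞ M, x ∈ φ.source ∧
    ∃ e : Model n ≃L[ℝ] (Fin n → ℝ) × (Fin n → ℝ), ∀ z ∈ φ.source, ∀ v : Tan n z,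
      e (mfderiv (𝓡 (2 * n)) 𝓘(ℝ, Model n) φ z (endo z v)) =
        (0, (e (mfderiv (𝓡 (2 * n)) 𝓘(ℝ, Model n) φ z v)).1)

namespace TangentStructure

variable (S : TangentStructure n M)

/-- The tangent bundle of the vertical foliation. -/
def vert (x : M) : Submodule ℝ (Tan n x) := (S.endo x).range

/-- The vector field `S X`. -/
def app (X : ∀ x : M, Tan n x) : ∀ x : M, Tan n x := fun x => S.endo x (X x)

/-- Foliated functions on an open set: smooth functions, constant along the leaves (that is, locally
depending only on the coordinates `xⁱ`). -/
def FoliatedFun (W : Opens M) (f : M → ℝ) : Prop :=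
  ContMDiffOn (𝓡 (2 * n)) 𝓘(ℝ, ℝ) ∞ f W ∧
    ∀ x ∈ W, ∀ v ∈ S.vert x, diff f x v = 0

/-- Foliated (projectable) vector fields on an open set: smooth vector fields which map foliated
functions to foliated functions, that is, which are locally of the form
`∑ ξⁱ(x) ∂/∂xⁱ + ∑ ζⁱ(x, y) ∂/∂yⁱ`. -/
def FoliatedField (W : Opens M) (X : ∀ x : M, Tan n x) : Prop :=
  VFSmoothOn X W ∧ ∀ W' ≤ W, ∀ f, S.FoliatedFun W' f → S.FoliatedFun W' (dirDeriv X f)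

/-- Leafwise affine functions on an open set: smooth functions `f` such that `Y f` is foliated for
every local parallel vector field `Y = S X` (with `X` foliated) along the leaves. In coordinates,
`f = ∑ αᵢ(x) yⁱ + β(x)`. -/
def LeafwiseAffine (W : Opens M) (f : M → ℝ) : Prop :=
  ContMDiffOn (𝓡 (2 * n)) 𝓘(ℝ, ℝ) ∞ f W ∧
    ∀ W' ≤ W, ∀ X, S.FoliatedField W' X → S.FoliatedFun W' (dirDeriv (S.app X) f)

/-- Foliated 1-forms of type `(1, 0)` on an open set, that is, foliated sections of the dual of the
transversal bundle: smooth 1-forms which vanish on vertical vectors and take foliated values on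
foliated vector fields. In coordinates, `ξ = ∑ ξᵢ(x) dxⁱ`. -/
def FoliatedOneForm (W : Opens M) (ξ : Form n M 1) : Prop :=
  ξ.SmoothOn W ∧ (∀ x ∈ W, ∀ v ∈ S.vert x, ξ x (fun _ => v) = 0) ∧
    ∀ W' ≤ W, ∀ X, S.FoliatedField W' X → S.FoliatedFun W' (fun x => ξ x (fun _ => X x))

/-- The 1-form `θ_L (X) = (S X) L`. -/
def theta (L : M → ℝ) : Form n M 1 :=
  oneForm fun x => (diff L x).comp (S.endo x)

/-- On the open set `U`, the bilinear form `g` is the Hessian of `L`: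
`g_x(X₁, X₂) = ((S X₂) (S X₁) L)(x)` for every local foliated extension of `X₁`
(the expression depends only on the value at `x` of `X₂`). -/
def IsHessian (L : M → ℝ) (U : Opens M) (g : ∀ x : M, Tan n x →L[ℝ] Tan n x →L[ℝ] ℝ) : Prop :=
  ∀ W ≤ U, ∀ X, S.FoliatedField W X → ∀ x ∈ W, ∀ v : Tan n x,
    g x (X x) v = diff (dirDeriv (S.app X) L) x (S.endo x v)

/-- A normal bundle of the vertical foliation: a complementary distribution of the vertical bundle,
smooth in the sense that the projection onto the vertical bundle is smooth. -/
structure NormalBundle where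
  N : ∀ x : M, Submodule ℝ (Tan n x)
  isCompl : ∀ x, IsCompl (N x) (S.vert x)
  proj : ∀ x : M, Tan n x →L[ℝ] Tan n x
  proj_normal : ∀ x, ∀ v ∈ N x, proj x v = 0
  proj_vert : ∀ x, ∀ v ∈ S.vert x, proj x v = v
  smooth : EndoSmooth proj

end TangentStructure


/-! Elementary facts on these notions, needed for the sheaves and the cocycle below. -/

section Helpers

open Bundle Filter

theorem dirDeriv_smoothOn {W : Opens M} {X : ∀ x : M, Tan n x} (hX : VFSmoothOn X W) {f : M → ℝ}
    (hf : ContMDiffOn (𝓡 (2 * n)) 𝓘(ℝ, ℝ) ∞ f W) :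
    ContMDiffOn (𝓡 (2 * n)) 𝓘(ℝ, ℝ) ∞ (dirDeriv X f) W := by
  have h1 := hf.contMDiffOn_tangentMapWithin (m := ∞) (by simp) W.isOpen.uniqueMDiffOn
  have h2 := h1.comp hX (fun x hx => hx)
  have h3 := (contMDiff_snd_tangentBundle_modelSpace ℝ 𝓘(ℝ, ℝ) (n := ∞)).comp_contMDiffOn h2
  refine h3.congr ?_
  intro x hx
  have : (diff f x : Tan n x →L[ℝ] ℝ) = mfderivWithin (𝓡 (2 * n)) 𝓘(ℝ, ℝ) f W x :=
    (mfderivWithin_of_isOpen W.isOpen hx).symm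
  rw [dirDeriv, this]
  rfl

namespace TangentStructure

theorem app_smoothOn (S : TangentStructure n M) {W : Opens M} {X : ∀ x : M, Tan n x}
    (hX : VFSmoothOn X W) : VFSmoothOn (S.app X) W :=
  ContMDiffOn.clm_bundle_apply (S.smooth.contMDiffOn (s := W)) hX

variable {S : TangentStructure n M}

theorem FoliatedFun.mono {W W' : Opens M} {f : M → ℝ} (h : S.FoliatedFun W f) (hW : W' ≤ W) :
    S.FoliatedFun W' f :=
  ⟨h.1.mono hW, fun x hx => h.2 x (hW hx)⟩

theorem FoliatedFun.congr {W : Opens M} {f f' : M → ℝ} (h : S.FoliatedFun W f)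
    (hf : ∀ x ∈ W, f x = f' x) : S.FoliatedFun W f' :=
  ⟨h.1.congr (fun x hx => (hf x hx).symm), fun x hx v hv => by
    rw [← diff_congr_on hf hx]; exact h.2 x hx v hv⟩

theorem FoliatedFun.add {W : Opens M} {f f' : M → ℝ} (h : S.FoliatedFun W f)
    (h' : S.FoliatedFun W f') : S.FoliatedFun W (f + f') :=
  ⟨h.1.add h'.1, fun x hx v hv => by
    rw [diff_add h.1 h'.1 hx, add_apply, h.2 x hx v hv, h'.2 x hx v hv,
      add_zero]⟩

theorem FoliatedFun.neg {W : Opens M} {f : M → ℝ} (h : S.FoliatedFun W f) :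
    S.FoliatedFun W (-f) :=
  ⟨h.1.neg, fun x hx v hv => by
    rw [diff_neg, neg_apply, h.2 x hx v hv, neg_zero]⟩

theorem FoliatedFun.zero (W : Opens M) : S.FoliatedFun W 0 :=
  ⟨contMDiffOn_const, fun x _ v _ => by
    rw [diff_zero, zero_apply]⟩

end TangentStructure

theorem theta_smoothOn (S : TangentStructure n M) {W : Opens M} {f : M → ℝ}
    (hf : ContMDiffOn (𝓡 (2 * n)) 𝓘(ℝ, ℝ) ∞ f W) : (S.theta f).SmoothOn W := by
  intro x₀ hx₀
  set φ := chartAt (Model n) x₀ with hφ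
  have hx₀φ : x₀ ∈ φ.source := mem_chart_source _ x₀
  have hcore := ((contMDiffAt_hom_bundle _).1 (S.smooth x₀)).2
  have hsymm : ContMDiffAt 𝓘(ℝ, Model n) (𝓡 (2 * n)) ∞ φ.symm (φ x₀) :=
    contMDiffOn_chart_symm.contMDiffAt (φ.open_target.mem_nhds (mem_chart_target _ x₀))
  have hinv : φ.symm (φ x₀) = x₀ := φ.left_inv hx₀φ
  -- the endomorphism in the chart
  have hB : ContDiffAt ℝ ∞ (fun e => ContinuousLinearMap.inCoordinates (Model n)
      (TangentSpace (𝓡 (2 * n)) (M := M)) (Model n) (TangentSpace (𝓡 (2 * n)) (M := M)) x₀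
      (φ.symm e) x₀ (φ.symm e) (S.endo (φ.symm e))) (φ x₀) := by
    rw [← contMDiffAt_iff_contDiffAt]
    exact ContMDiffAt.comp (φ x₀) (by rw [hinv]; exact hcore) hsymm
  have hfs : ∀ e ∈ φ.target, φ.symm e ∈ W →
      ContDiffAt ℝ ∞ (f ∘ φ.symm) e := by
    intro e he hW
    rw [← contMDiffAt_iff_contDiffAt]
    exact ContMDiffAt.comp e (hf.contMDiffAt (W.isOpen.mem_nhds hW))
      (contMDiffOn_chart_symm.contMDiffAt (φ.open_target.mem_nhds he))
  have hA : ContDiffAt ℝ ∞ (fderiv ℝ (f ∘ φ.symm)) (φ x₀) :=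
    (hfs (φ x₀) (mem_chart_target _ x₀) (by rw [hinv]; exact hx₀)).fderiv_right (m := ∞) (by simp)
  have hcomp := (ContinuousAlternatingMap.ofSubsingletonLIE (𝕜 := ℝ) (E := Model n) (F := ℝ)
    (0 : Fin 1)).contDiff.contDiffAt.comp (φ x₀) (hA.clm_comp hB)
  refine hcomp.congr_of_eventuallyEq ?_
  have hWm : (W : Set M) ∈ 𝓝 (φ.symm (φ x₀)) := by
    rw [hinv]
    exact W.isOpen.mem_nhds hx₀
  filter_upwards [φ.open_target.mem_nhds (mem_chart_target _ x₀),
    (φ.continuousAt_symm (mem_chart_target _ x₀)).preimage_mem_nhds hWm] with e he hW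
  have hy : φ.symm e ∈ φ.source := φ.map_target he
  have hsy : (trivializationAt (Model n) (TangentSpace (𝓡 (2 * n))) x₀).symmL ℝ (φ.symm e) =
      mfderiv 𝓘(ℝ, Model n) (𝓡 (2 * n)) φ.symm e := by
    rw [TangentBundle.symmL_trivializationAt hy]
    simp only [mfld_simps, mfderivWithin_univ]
    let G : Model n → (Model n →L[ℝ] Model n) := fun e' =>
      mfderiv 𝓘(ℝ, Model n) (𝓡 (2 * n)) φ.symm e'
    exact congrArg G (φ.right_inv he)
  have hd : fderiv ℝ (f ∘ φ.symm) e =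
      (diff f (φ.symm e)).comp (mfderiv 𝓘(ℝ, Model n) (𝓡 (2 * n)) φ.symm e) := by
    rw [← mfderiv_eq_fderiv]
    exact mfderiv_comp e (mdiff_of_smoothOn hf hW)
      ((contMDiffOn_chart_symm.contMDiffAt (φ.open_target.mem_nhds he)).mdifferentiableAt (n := ∞) (by simp))
  ext v
  change diff f (φ.symm e) (S.endo (φ.symm e)
    (mfderiv 𝓘(ℝ, Model n) (𝓡 (2 * n)) φ.symm e (v 0))) = _
  change _ = fderiv ℝ (f ∘ φ.symm) e (ContinuousLinearMap.inCoordinates (Model n)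
      (TangentSpace (𝓡 (2 * n)) (M := M)) (Model n) (TangentSpace (𝓡 (2 * n)) (M := M)) x₀
      (φ.symm e) x₀ (φ.symm e) (S.endo (φ.symm e)) (v 0))
  rw [hd, ContinuousLinearMap.inCoordinates, ← hsy]
  have h := Trivialization.symmL_continuousLinearMapAt (R := ℝ)
    (trivializationAt (Model n) (TangentSpace (𝓡 (2 * n)) (M := M)) x₀) (b := φ.symm e) hy
  exact congrArg (diff f (φ.symm e)) (h _).symm

end Helpers

end Tangent

/-! ### Bigrading and the operator `d''` -/

section Bigrading

variable {n : ℕ} {M : Type u} [TopologicalSpace M] [ChartedSpace (Model n) M]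
  [IsManifold (𝓡 (2 * n)) ∞ M]

/-- For endomorphisms `h`, `v`, the sum over the `p`-element sets `A` of arguments of the form
obtained from `η` by applying `h` to the arguments in `A` and `v` to the other ones. -/
def bidegreePart {V : Type*} [AddCommGroup V] [Module ℝ V] [TopologicalSpace V]
    (h v : V →L[ℝ] V) {k : ℕ} (p : ℕ) (η : V [⋀^Fin k]→L[ℝ] ℝ) : V [⋀^Fin k]→L[ℝ] ℝ where
  toContinuousMultilinearMap := ∑ A ∈ Finset.powersetCard p (Finset.univ : Finset (Fin k)),
    η.toContinuousMultilinearMap.compContinuousLinearMap (fun i => if i ∈ A then h else v)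
  map_eq_zero_of_eq' := by
    intro w i j hij hne
    have key : ∀ A : Finset (Fin k), ((fun l => (if l ∈ A.map (Equiv.swap i j).toEmbedding
        then h else v) (w l)) : Fin k → V) =
        (fun l => (if l ∈ A then h else v) (w l)) ∘ Equiv.swap i j := by
      intro A
      funext l
      have hm : l ∈ A.map (Equiv.swap i j).toEmbedding ↔ Equiv.swap i j l ∈ A := by
        rw [Finset.mem_map_equiv, Equiv.symm_swap]
      have hw : w (Equiv.swap i j l) = w l := by
        rcases eq_or_ne l i with rfl | hi
        · rw [Equiv.swap_apply_left, hij]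
        · rcases eq_or_ne l j with rfl | hj
          · rw [Equiv.swap_apply_right, hij]
          · rw [Equiv.swap_apply_of_ne_of_ne hi hj]
      simp only [Function.comp_apply, hm, hw]
    have hsum : ∑ A ∈ Finset.powersetCard p (Finset.univ : Finset (Fin k)),
        η (fun l => (if l ∈ A then h else v) (w l)) = 0 := by
      refine Finset.sum_involution (fun A _ => A.map (Equiv.swap i j).toEmbedding) ?_ ?_ ?_ ?_
      · intro A _
        rw [key, add_comm]
        exact η.toAlternatingMap.map_swap_add _ hne
      · intro A _ hA hfix
        apply hA
        have hk := key A
        rw [hfix] at hk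
        refine η.map_eq_zero_of_eq _ (i := i) (j := j) ?_ hne
        have := congrFun hk i
        simpa using this
      · intro A hA
        rw [Finset.mem_powersetCard] at hA ⊢
        exact ⟨Finset.subset_univ _, by rw [Finset.card_map]; exact hA.2⟩
      · intro A _
        ext l
        simp [Finset.mem_map_equiv]
    simpa using hsum

namespace TangentStructure

variable {S : TangentStructure n M}

/-- The component of type `(p, k - p)` of a `k`-form with respect to the decomposition of the tangent
bundle into the normal bundle and the vertical bundle. -/
def NormalBundle.part (N : S.NormalBundle) {k : ℕ} (p : ℕ) (η : Form n M k) : Form n M k :=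
  fun x => bidegreePart (ContinuousLinearMap.id ℝ (Tan n x) - N.proj x) (N.proj x) p (η x)

/-- Forms of type `(p, q)`. -/
def NormalBundle.IsOfType (N : S.NormalBundle) (p q : ℕ) {k : ℕ} (η : Form n M k) : Prop :=
  k = p + q ∧ N.part p η = η

/-- The operator `d''`, the part of bidegree `(0, 1)` of the exterior derivative: on a form of type
`(p, q)` it is the component of type `(p, q + 1)` of the exterior derivative. -/
def NormalBundle.dpp (N : S.NormalBundle) {k : ℕ} (η : Form n M k) : Form n M (k + 1) :=
  ∑ p ∈ Finset.range (k + 1), N.part p (N.part p η).d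

/-- `d''`-exact 2-forms. (As `d''` has bidegree `(0, 1)`, for a form of type `(1, 1)` it does not
matter whether the primitive is required to be of type `(1, 0)`.) -/
def NormalBundle.DppExact (N : S.NormalBundle) (η : Form n M 2) : Prop :=
  ∃ μ : Form n M 1, μ.Smooth ∧ N.dpp μ = η

end TangentStructure

end Bigrading

/-! ### Locally Lagrange spaces and the Lagrangian obstructions -/

section Lagrange

open TopologicalSpace CategoryTheory

variable {n : ℕ} {M : Type u} [TopologicalSpace M] [ChartedSpace (Model n) M]
  [IsManifold (𝓡 (2 * n)) ∞ M]

namespace TangentStructure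

variable (S : TangentStructure n M)

/-- The leafwise affine functions. -/
def affineClass : LocalClass (fun _ : M => ℝ) where
  Mem := S.LeafwiseAffine
  zero_mem U := ⟨contMDiffOn_const, fun W' _ X _ => by
    rw [dirDeriv_zero]; exact FoliatedFun.zero W'⟩
  add_mem U s t hs ht := ⟨hs.1.add ht.1, fun W' hW X hX =>
    ((hs.2 W' hW X hX).add (ht.2 W' hW X hX)).congr
      (fun x hx => (dirDeriv_add hs.1 ht.1 _ x (hW hx)).symm)⟩
  neg_mem U s hs := ⟨hs.1.neg, fun W' hW X hX => by
    rw [dirDeriv_neg]; exact (hs.2 W' hW X hX).neg⟩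
  mono U V h s hs := ⟨hs.1.mono h, fun W' hW => hs.2 W' (hW.trans h)⟩
  congr U s t h hs := ⟨hs.1.congr (fun x hx => (h x hx).symm), fun W' hW X hX =>
    (hs.2 W' hW X hX).congr (fun x hx => dirDeriv_congr_on h _ x (hW hx))⟩

/-- The foliated 1-forms of type `(1, 0)`. -/
def foliatedFormClass : LocalClass (fun x : M => (Tan n x) [⋀^Fin 1]→L[ℝ] ℝ) where
  Mem := S.FoliatedOneForm
  zero_mem U := by
    refine ⟨fun x _ => ?_, fun _ _ _ _ => rfl, fun W' _ _ _ => FoliatedFun.zero W'⟩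
    rw [inChart_zero]
    exact contDiffAt_const
  add_mem U s t hs ht := by
    refine ⟨fun x hx => ?_, fun x hx v hv => ?_, fun W' hW X hX =>
      (hs.2.2 W' hW X hX).add (ht.2.2 W' hW X hX)⟩
    · rw [inChart_add]
      exact (hs.1 x hx).add (ht.1 x hx)
    · exact (congrArg₂ (· + ·) (hs.2.1 x hx v hv) (ht.2.1 x hx v hv)).trans (add_zero _)
  neg_mem U s hs := by
    refine ⟨fun x hx => ?_, fun x hx v hv => ?_, fun W' hW X hX => (hs.2.2 W' hW X hX).neg⟩
    · rw [inChart_neg]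
      exact (hs.1 x hx).neg
    · exact (congrArg (- ·) (hs.2.1 x hx v hv)).trans neg_zero
  mono U V h s hs := ⟨fun x hx => hs.1 x (h hx), fun x hx => hs.2.1 x (h hx),
    fun W' hW => hs.2.2 W' (hW.trans h)⟩
  congr U s t h hs := by
    refine ⟨fun x hx => ?_, fun x hx v hv => ?_, fun W' hW X hX =>
      (hs.2.2 W' hW X hX).congr (fun x hx => by rw [h x (hW hx)])⟩
    · exact (hs.1 x hx).congr_of_eventuallyEq (inChart_congr h hx).symm
    · rw [← h x hx]
      exact hs.2.1 x hx v hv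

/-- The sheaf of leafwise affine functions. -/
def sheafA : AbPresheaf M := S.affineClass.presheaf

/-- The sheaf of foliated 1-forms of type `(1, 0)`. -/
def sheafOmega : AbPresheaf M := S.foliatedFormClass.presheaf

/-- The homomorphism `π'`, given by `∑ αᵢ(x) yⁱ + β(x) ↦ ∑ αᵢ(x) dxⁱ`, that is, `f ↦ df ∘ S`. -/
def piPrime : S.sheafA ⟶ S.sheafOmega :=
  LocalClass.hom S.affineClass S.foliatedFormClass S.theta
    (fun U s t hs ht x hx => by
      simp only [theta, oneForm]
      rw [diff_add hs.1 ht.1 hx]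
      rfl)
    (fun U s t h x hx => by
      simp only [theta, oneForm]
      rw [diff_congr_on h hx])
    (fun U s hs => by
      refine ⟨theta_smoothOn S hs.1, fun x _ v hv => ?_, fun W' hW X hX => hs.2 W' hW X hX⟩
      obtain ⟨w, rfl⟩ := hv
      have : diff s x (S.endo x (S.endo x w)) = 0 := by
        rw [S.sq_eq_zero, map_zero]
      exact this)

/-- A locally Lagrange space with underlying tangent manifold `(M, S)`: a non-degenerate symmetric
tensor field `g` on the transversal bundle (seen as a tensor field on `M` annihilated by vertical
vectors), and an open covering with local Lagrangians of which `g` is the Hessian. The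
Lagrangian `L α` is a function of which only the values on `U α` count; it is regular
since `g` is non-degenerate on the transversal bundle. -/
structure LocallyLagrange (ι : Type w) where
  g : ∀ x : M, Tan n x →L[ℝ] Tan n x →L[ℝ] ℝ
  smooth : BilinSmooth g
  symm : ∀ (x : M) (v w : Tan n x), g x v w = g x w v
  transversal : ∀ (x : M) (v w : Tan n x), v ∈ S.vert x → g x v w = 0
  nondegenerate : ∀ (x : M) (v : Tan n x), (∀ w : Tan n x, g x v w = 0) → v ∈ S.vert x
  U : ι → Opens M
  cover : ∀ x, ∃ α, x ∈ U α
  L : ι → M → ℝ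
  smooth_L : ∀ α, ContMDiffOn (𝓡 (2 * n)) 𝓘(ℝ, ℝ) ∞ (L α) (U α)
  hessian : ∀ α, S.IsHessian (L α) (U α) g

namespace LocallyLagrange

variable {S} {ι : Type w} (Λ : S.LocallyLagrange ι)

theorem sub_leafwiseAffine (α β : ι) : S.LeafwiseAffine (Λ.U α ⊓ Λ.U β) (Λ.L β - Λ.L α) := by
  have hα : ContMDiffOn (𝓡 (2 * n)) 𝓘(ℝ, ℝ) ∞ (Λ.L α) (Λ.U α ⊓ Λ.U β : Opens M) :=
    (Λ.smooth_L α).mono (fun x hx => hx.1)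
  have hβ : ContMDiffOn (𝓡 (2 * n)) 𝓘(ℝ, ℝ) ∞ (Λ.L β) (Λ.U α ⊓ Λ.U β : Opens M) :=
    (Λ.smooth_L β).mono (fun x hx => hx.2)
  refine ⟨hβ.sub hα, fun W hW X hX => ?_⟩
  have hsX : VFSmoothOn (S.app X) W := S.app_smoothOn hX.1
  have hα' : ContMDiffOn (𝓡 (2 * n)) 𝓘(ℝ, ℝ) ∞ (dirDeriv (S.app X) (Λ.L α)) W :=
    dirDeriv_smoothOn hsX (hα.mono hW)
  have hβ' : ContMDiffOn (𝓡 (2 * n)) 𝓘(ℝ, ℝ) ∞ (dirDeriv (S.app X) (Λ.L β)) W :=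
    dirDeriv_smoothOn hsX (hβ.mono hW)
  have hneg : ContMDiffOn (𝓡 (2 * n)) 𝓘(ℝ, ℝ) ∞ (-Λ.L α) W := (hα.mono hW).neg
  have heq : ∀ x ∈ W, (dirDeriv (S.app X) (Λ.L β) + -dirDeriv (S.app X) (Λ.L α)) x =
      dirDeriv (S.app X) (Λ.L β - Λ.L α) x := by
    intro x hx
    rw [sub_eq_add_neg, dirDeriv_add (hβ.mono hW) hneg _ x hx, dirDeriv_neg]
  refine FoliatedFun.congr ⟨hβ'.add hα'.neg, fun x hx v hv => ?_⟩ heq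
  obtain ⟨w, rfl⟩ := hv
  have h1 := Λ.hessian α W (hW.trans inf_le_left) X hX x hx w
  have h2 := Λ.hessian β W (hW.trans inf_le_right) X hX x hx w
  rw [diff_add hβ' hα'.neg hx]
  refine (congrArg₂ (· + ·) h2.symm (?_ : _ = -(Λ.g x (X x) w))).trans (add_neg_cancel _)
  rw [h1]
  exact congrArg (fun a : Tan n x →L[ℝ] ℝ => a (S.endo x w)) (diff_neg _ x)

/-- The cocycle `L_β - L_α` of leafwise affine functions. -/
def cocycle : Z1 S.sheafA Λ.U :=
  ⟨fun α β => S.affineClass.toSection (Λ.U α ⊓ Λ.U β) (Λ.L β - Λ.L α)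
    (Λ.sub_leafwiseAffine α β), by
      intro α β γ
      apply Subtype.ext
      funext x
      change (Λ.L γ x - Λ.L β x) - (Λ.L γ x - Λ.L α x) + (Λ.L β x - Λ.L α x) = 0
      ring⟩

/-- The total Lagrangian obstruction, in the first cohomology of the sheaf of leafwise affine
functions. -/
def totalObstruction : H1 S.sheafA := ofCover S.sheafA Λ.U Λ.cover (QuotientAddGroup.mk Λ.cocycle)

/-- The first Lagrangian obstruction, in the first cohomology of the sheaf of foliated 1-forms of
type `(1, 0)`. -/
def firstObstruction : H1 S.sheafOmega := mapH1 S.piPrime Λ.totalObstruction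

end LocallyLagrange

end TangentStructure

end Lagrange

end

end LocLagrange

/-!
The form `Θ` is determined by the metric. As `θ_L` vanishes on vertical vectors and the vertical
distribution is integrable, `dθ_L` has no component of type `(0, 2)`, and a computation in
coordinates in which `S` is constant gives `dθ_L (u, S w) = - g (u, w)` whenever `g = Hess L`
(`d_theta_apply`). As `d''θ_L` is the component of type `(1, 1)` of `dθ_L`, it is given by a
formula in `g`, `S` and the projection onto the vertical bundle (`dpp_theta_apply`), in which `L`
does not occur. Hence the forms `d''θ_{L α}` glue, and the non-degeneracy of `g` on the
transversal bundle gives that of `Θ`.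

The difference `Θ - dθ_{L α}` is of type `(2, 0)`, that is, it vanishes as soon as one argument is
vertical. By integrability again, its differential vanishes as soon as two arguments are vertical
(`d_apply_eq_zero_of_vert`), so `dΘ` has the same component of type `(1, 2)` as `ddθ_{L α} = 0`,
and this component is `d''Θ`.

For the obstruction, the point is that a 1-form `ξ` of type `(1, 0)` is foliated if and only if
`d''ξ = 0` (`FoliatedOneForm.d_apply`, `foliatedOneForm_of_d`). The class `π'^*(𝒢)` is represented
by the cocycle `θ_{L β} - θ_{L α}`. If, on a refinement, it is the coboundary of foliated forms `b
α`, the forms `θ_{L α} - b α` glue to a form `μ` with `d''μ = Θ`. Conversely, if `Θ = d''μ`, then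
the component `μ'` of type `(1, 0)` of `μ` satisfies `d''μ' = Θ` as well, since the other
component only contributes to type `(0, 2)`; so the forms `θ_{L α} - μ'` are foliated, with
coboundary `θ_{L β} - θ_{L α}`. No partition of unity is needed, so that `M` may be an arbitrary,
possibly non-Hausdorff, manifold.

The exterior derivative at a point is defined by the preferred chart at this point; by
`Form.SmoothOn.inC_d` it can be computed in any chart of the maximal atlas, in particular in the
charts adapted to `S`.
-/

namespace LocLagrange

universe u w

noncomputable section

/-! ### Smooth families of alternating maps -/

section Alternating

variable {D E : Type*} [NormedAddCommGroup D] [NormedSpace ℝ D] [NormedAddCommGroup E]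
  [NormedSpace ℝ E] {k : ℕ} {m : WithTop ℕ∞} {x : D}

theorem bidegreePart_apply {V : Type*} [AddCommGroup V] [Module ℝ V] [TopologicalSpace V]
    (h v : V →L[ℝ] V) (p : ℕ) (η : V [⋀^Fin k]→L[ℝ] ℝ) (w : Fin k → V) :
    bidegreePart h v p η w = ∑ A ∈ Finset.powersetCard p (Finset.univ : Finset (Fin k)),
      η (fun i => (if i ∈ A then h else v) (w i)) := by
  change (∑ A ∈ _, _ : ContinuousMultilinearMap ℝ _ _) w = _
  simp

theorem contDiffAt_alternating_apply {F : D → E [⋀^Fin k]→L[ℝ] ℝ} {g : Fin k → D → E}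
    (hF : ContDiffAt ℝ m F x) (hg : ∀ i, ContDiffAt ℝ m (g i) x) :
    ContDiffAt ℝ m (fun e => F e (fun i => g i e)) x := by
  let T : ContinuousMultilinearMap ℝ (fun _ : Fin k => ℝ →L[ℝ] E)
      (ContinuousMultilinearMap ℝ (fun _ : Fin k => E) ℝ →L[ℝ]
        ContinuousMultilinearMap ℝ (fun _ : Fin k => ℝ) ℝ) :=
    ContinuousMultilinearMap.compContinuousLinearMapContinuousMultilinear ℝ
    (fun _ : Fin k => ℝ) (fun _ : Fin k => E) ℝ
  let S := ContinuousLinearMap.smulRightL ℝ ℝ E (1 : ℝ →L[ℝ] ℝ)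
  let J := ContinuousAlternatingMap.toContinuousMultilinearMapCLM ℝ (𝕜 := ℝ) (E := E) (F := ℝ)
    (ι := Fin k)
  have hJ : ContDiff ℝ m J := J.contDiff
  have hT : ContDiff ℝ m T := by apply ContinuousMultilinearMap.contDiff
  have h1 : ContDiffAt ℝ m (fun e => J (F e)) x := hJ.contDiffAt.comp x hF
  have h2 : ContDiffAt ℝ m
      (fun e => (fun i => (S (g i e)))) x :=
    contDiffAt_pi.2 fun i =>
      (S).contDiff.contDiffAt.comp x (hg i)
  have h3 : ContDiffAt ℝ m (fun e => T (fun i => S (g i e))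
      (J (F e))) x := 
    (hT.contDiffAt.comp x h2).clm_apply h1
  have h4 := ((ContinuousMultilinearMap.apply ℝ (fun _ : Fin k => ℝ) ℝ
    (fun _ => (1 : ℝ))).contDiff (n := m)).contDiffAt.comp x h3
  refine h4.congr_of_eventuallyEq (Filter.Eventually.of_forall fun e => ?_)
  simp [T, S, J]

/-- In finite dimension, a family of alternating maps is smooth as soon as its values on fixed
vectors are. -/
theorem contDiffAt_alternating_of_apply [FiniteDimensional ℝ E] {F : D → E [⋀^Fin k]→L[ℝ] ℝ}
    (h : ∀ v, ContDiffAt ℝ m (fun e => F e v) x) : ContDiffAt ℝ m F x := by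
  let b := Module.finBasis ℝ E
  let ev : (E [⋀^Fin k]→L[ℝ] ℝ) →ₗ[ℝ] ((Fin k → Fin (Module.finrank ℝ E)) → ℝ) :=
    { toFun := fun f s => f (fun i => b (s i))
      map_add' := fun _ _ => rfl
      map_smul' := fun _ _ => rfl }
  have hinj : Function.Injective ev := by
    intro f g hfg
    apply ContinuousAlternatingMap.toAlternatingMap_injective
    exact Module.Basis.ext_alternating b (fun s _ => congrFun hfg s)
  obtain ⟨l, hl⟩ := ev.exists_leftInverse_of_injective (LinearMap.ker_eq_bot.2 hinj)
  have h1 : ContDiffAt ℝ m (fun e => ev (F e)) x := contDiffAt_pi.2 fun s => h _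
  have h2 := (LinearMap.toContinuousLinearMap l).contDiff.contDiffAt.comp x h1
  refine h2.congr_of_eventuallyEq (Filter.Eventually.of_forall fun e => ?_)
  exact (LinearMap.congr_fun hl (F e)).symm

theorem contDiffAt_alternating_comp [FiniteDimensional ℝ E] {F : D → E [⋀^Fin k]→L[ℝ] ℝ}
    {A : D → E →L[ℝ] E} (hF : ContDiffAt ℝ m F x) (hA : ContDiffAt ℝ m A x) :
    ContDiffAt ℝ m (fun e => (F e).compContinuousLinearMap (A e)) x :=
  contDiffAt_alternating_of_apply fun v =>
    contDiffAt_alternating_apply (g := fun i e => A e (v i)) hF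
      fun _ => hA.clm_apply contDiffAt_const

theorem contDiffAt_bidegreePart [FiniteDimensional ℝ E] {F : D → E [⋀^Fin k]→L[ℝ] ℝ}
    {h v : D → E →L[ℝ] E} (p : ℕ) (hF : ContDiffAt ℝ m F x) (hh : ContDiffAt ℝ m h x)
    (hv : ContDiffAt ℝ m v x) :
    ContDiffAt ℝ m (fun e => bidegreePart (h e) (v e) p (F e)) x := by
  refine contDiffAt_alternating_of_apply fun w => ?_
  simp only [bidegreePart_apply]
  refine ContDiffAt.sum fun A _ => contDiffAt_alternating_apply hF fun i => ?_
  split_ifs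
  · exact hh.clm_apply contDiffAt_const
  · exact hv.clm_apply contDiffAt_const

/-- If a `k`-form vanishes as soon as one of its arguments lies in a fixed subset `V`, then its
exterior derivative vanishes as soon as two of its arguments lie in `V`. -/
theorem extDeriv_apply_eq_zero {ζ : E → E [⋀^Fin k]→L[ℝ] ℝ} {e : E} (hζ : DifferentiableAt ℝ ζ e)
    {V : Set E} (h0 : ∀ᶠ y in 𝓝 e, ∀ v : Fin k → E, ∀ i, v i ∈ V → ζ y v = 0)
    {v : Fin (k + 1) → E} {i j : Fin (k + 1)} (hij : i ≠ j) (hi : v i ∈ V) (hj : v j ∈ V) :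
    extDeriv ζ e v = 0 := by
  rw [extDeriv_apply hζ]
  refine Finset.sum_eq_zero fun l _ => ?_
  have hex : ∃ l', l.removeNth v l' ∈ V := by
    rcases eq_or_ne i l with rfl | hl
    · obtain ⟨l', rfl⟩ := Fin.exists_succAbove_eq hij.symm
      exact ⟨l', hj⟩
    · obtain ⟨l', rfl⟩ := Fin.exists_succAbove_eq hl
      exact ⟨l', hi⟩
  obtain ⟨l', hl'⟩ := hex
  have : (fun y => ζ y (l.removeNth v)) =ᶠ[𝓝 e] fun _ => 0 := by
    filter_upwards [h0] with y hy using hy _ l' hl'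
  rw [this.fderiv_eq]
  simp

theorem extDeriv_one_apply {ζ : E → E [⋀^Fin 1]→L[ℝ] ℝ} {e : E} (hζ : DifferentiableAt ℝ ζ e)
    (a b : E) : extDeriv ζ e ![a, b] =
      fderiv ℝ (fun y => ζ y (fun _ => b)) e a - fderiv ℝ (fun y => ζ y (fun _ => a)) e b := by
  rw [extDeriv_apply hζ, Fin.sum_univ_two]
  have h0 : (0 : Fin 2).removeNth ![a, b] = fun _ => b := by
    funext i; fin_cases i; rfl
  have h1 : (1 : Fin 2).removeNth ![a, b] = fun _ => a := by
    funext i; fin_cases i; rfl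
  rw [h0, h1]
  simp [sub_eq_add_neg]

end Alternating

/-! ### Forms and the exterior derivative in arbitrary charts -/

section Charts

open TopologicalSpace Filter

variable {n : ℕ} {M : Type u} [TopologicalSpace M]

theorem eventually_mem_target_and_symm_mem {φ : OpenPartialHomeomorph M (Model n)}
    {e : Model n} (he : e ∈ φ.target) {s : Set M} (hs : IsOpen s)
    (he' : φ.symm e ∈ s) : ∀ᶠ y in 𝓝 e, y ∈ φ.target ∧ φ.symm y ∈ s :=
  Filter.Eventually.and (φ.open_target.mem_nhds he)
    ((φ.continuousAt_symm he).preimage_mem_nhds (hs.mem_nhds he'))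

variable [ChartedSpace (Model n) M]

/-- The differential at `x` of a map to the model space. The tangent space at `x` is the model space
by definition; it is written as the model space here, so that base points can be rewritten. -/
def tanTo (φ : OpenPartialHomeomorph M (Model n)) (x : M) : Model n →L[ℝ] Model n :=
  mfderiv (𝓡 (2 * n)) 𝓘(ℝ, Model n) φ x

/-- The differential at `e` of the inverse of a chart, with the same convention as `tanTo`. -/
def tanFrom (φ : OpenPartialHomeomorph M (Model n)) (e : Model n) : Model n →L[ℝ] Model n :=
  mfderiv 𝓘(ℝ, Model n) (𝓡 (2 * n)) φ.symm e

/-- The expression of a form in the chart `φ`: its pull-back by the inverse of `φ`. -/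
def Form.inC {k : ℕ} (η : Form n M k) (φ : OpenPartialHomeomorph M (Model n)) (e : Model n) :
    (Model n) [⋀^Fin k]→L[ℝ] ℝ :=
  (show (Model n) [⋀^Fin k]→L[ℝ] ℝ from η (φ.symm e)).compContinuousLinearMap (tanFrom φ e)

theorem Form.inC_apply {k : ℕ} (η : Form n M k) (φ : OpenPartialHomeomorph M (Model n))
    (e : Model n) (v : Fin k → Model n) :
    η.inC φ e v = η (φ.symm e) (fun i => tanFrom φ e (v i)) := rfl

variable {φ ψ : OpenPartialHomeomorph M (Model n)}

section Differentials

theorem mdifferentiable_of_mem (hφ : φ ∈ IsManifold.maximalAtlas (𝓡 (2 * n)) ∞ M) :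
    φ.MDifferentiable (𝓡 (2 * n)) 𝓘(ℝ, Model n) :=
  ⟨(contMDiffOn_of_mem_maximalAtlas hφ).mdifferentiableOn (by simp),
    (contMDiffOn_symm_of_mem_maximalAtlas hφ).mdifferentiableOn (by simp)⟩

theorem tanTo_tanFrom (hφ : φ ∈ IsManifold.maximalAtlas (𝓡 (2 * n)) ∞ M) {e : Model n}
    (he : e ∈ φ.target) (w : Model n) : tanTo φ (φ.symm e) (tanFrom φ e w) = w :=
  DFunLike.congr_fun ((mdifferentiable_of_mem hφ).comp_symm_deriv he) w

theorem tanFrom_tanTo (hφ : φ ∈ IsManifold.maximalAtlas (𝓡 (2 * n)) ∞ M) {x : M}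
    (hx : x ∈ φ.source) (v : Model n) : tanFrom φ (φ x) (tanTo φ x v) = v :=
  DFunLike.congr_fun ((mdifferentiable_of_mem hφ).symm_comp_deriv hx) v

theorem contDiffAt_transition (hφ : φ ∈ IsManifold.maximalAtlas (𝓡 (2 * n)) ∞ M)
    (hψ : ψ ∈ IsManifold.maximalAtlas (𝓡 (2 * n)) ∞ M) {e : Model n} (he : e ∈ φ.target)
    (he' : φ.symm e ∈ ψ.source) : ContDiffAt ℝ ∞ (ψ ∘ φ.symm) e := by
  rw [← contMDiffAt_iff_contDiffAt]
  exact ContMDiffAt.comp e (contMDiffAt_of_mem_maximalAtlas hψ he')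
    (contMDiffAt_symm_of_mem_maximalAtlas hφ he)

/-- The chain rule for a change of charts. -/
theorem tanFrom_eq_comp (hφ : φ ∈ IsManifold.maximalAtlas (𝓡 (2 * n)) ∞ M)
    (hψ : ψ ∈ IsManifold.maximalAtlas (𝓡 (2 * n)) ∞ M) {e : Model n} (he : e ∈ φ.target)
    (he' : φ.symm e ∈ ψ.source) (v : Model n) :
    tanFrom φ e v = tanFrom ψ (ψ (φ.symm e)) (fderiv ℝ (ψ ∘ φ.symm) e v) := by
  have h1 : φ.symm =ᶠ[𝓝 e] ψ.symm ∘ (ψ ∘ φ.symm) := by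
    filter_upwards [eventually_mem_target_and_symm_mem he ψ.open_source he'] with y hy
    exact (ψ.left_inv hy.2).symm
  have h2 : HasMFDerivAt 𝓘(ℝ, Model n) 𝓘(ℝ, Model n) (ψ ∘ φ.symm) e
      (fderiv ℝ (ψ ∘ φ.symm) e) :=
    ((contDiffAt_transition hφ hψ he he').differentiableAt (by simp)).hasFDerivAt.hasMFDerivAt
  have h3 := ((mdifferentiable_of_mem hψ).mdifferentiableAt_symm
    (ψ.map_source he')).hasMFDerivAt
  have h4 := (HasMFDerivAt.comp e h3 h2).congr_of_eventuallyEq h1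
  exact DFunLike.congr_fun h4.mfderiv v

end Differentials

section Pullback

variable {k : ℕ} {η : Form n M k}

theorem Form.inC_eq_pullback (hφ : φ ∈ IsManifold.maximalAtlas (𝓡 (2 * n)) ∞ M)
    (hψ : ψ ∈ IsManifold.maximalAtlas (𝓡 (2 * n)) ∞ M) {e : Model n} (he : e ∈ φ.target)
    (he' : φ.symm e ∈ ψ.source) :
    η.inC φ e = (η.inC ψ ((ψ ∘ φ.symm) e)).compContinuousLinearMap (fderiv ℝ (ψ ∘ φ.symm) e) := by
  ext v
  -- `η` is a dependent function, so that its base point cannot be rewritten directly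
  have h : ∀ y (_ : y = φ.symm e) (b : Fin k → Model n),
      (show (Model n) [⋀^Fin k]→L[ℝ] ℝ from η y) b =
      (show (Model n) [⋀^Fin k]→L[ℝ] ℝ from η (φ.symm e)) b := by
    rintro y rfl b; rfl
  refine Eq.trans ?_ (h (ψ.symm (ψ (φ.symm e))) (ψ.left_inv he') _).symm
  rw [Form.inC_apply]
  exact congrArg (show (Model n) [⋀^Fin k]→L[ℝ] ℝ from η (φ.symm e))
    (funext fun i => tanFrom_eq_comp hφ hψ he he' (v i))

theorem Form.inC_eventuallyEq_pullback (hφ : φ ∈ IsManifold.maximalAtlas (𝓡 (2 * n)) ∞ M)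
    (hψ : ψ ∈ IsManifold.maximalAtlas (𝓡 (2 * n)) ∞ M) {e : Model n} (he : e ∈ φ.target)
    (he' : φ.symm e ∈ ψ.source) :
    η.inC φ =ᶠ[𝓝 e] fun y => (η.inC ψ ((ψ ∘ φ.symm) y)).compContinuousLinearMap
      (fderiv ℝ (ψ ∘ φ.symm) y) := by
  filter_upwards [eventually_mem_target_and_symm_mem he ψ.open_source he'] with y hy
  exact inC_eq_pullback hφ hψ hy.1 hy.2

theorem Form.contDiffAt_inC_of_inC (hφ : φ ∈ IsManifold.maximalAtlas (𝓡 (2 * n)) ∞ M)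
    (hψ : ψ ∈ IsManifold.maximalAtlas (𝓡 (2 * n)) ∞ M) {e : Model n} (he : e ∈ φ.target)
    (he' : φ.symm e ∈ ψ.source) (h : ContDiffAt ℝ ∞ (η.inC ψ) (ψ (φ.symm e))) :
    ContDiffAt ℝ ∞ (η.inC φ) e := by
  refine ContDiffAt.congr_of_eventuallyEq ?_ (inC_eventuallyEq_pullback hφ hψ he he')
  have ht := contDiffAt_transition hφ hψ he he'
  exact contDiffAt_alternating_comp (F := η.inC ψ ∘ (ψ ∘ φ.symm)) (ContDiffAt.comp e h ht)
    (ht.fderiv_right (by simp))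

theorem minSmoothness_two_le : minSmoothness ℝ 2 ≤ (∞ : WithTop ℕ∞) := by
  rw [minSmoothness_of_isRCLikeNormedField]
  exact WithTop.coe_le_coe.2 (le_top : (2 : ℕ∞) ≤ ⊤)

theorem Form.SmoothOn.mono {s t : Set M} (hη : η.SmoothOn s) (h : t ⊆ s) : η.SmoothOn t :=
  fun x hx => hη x (h hx)

theorem Form.SmoothOn.congr {W : Opens M} {ζ : Form n M k} (hη : η.SmoothOn W)
    (h : ∀ x ∈ W, η x = ζ x) : ζ.SmoothOn W :=
  fun x hx => (hη x hx).congr_of_eventuallyEq (inChart_congr h hx).symm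

theorem Form.SmoothOn.sub {s : Set M} {ζ : Form n M k} (hη : η.SmoothOn s) (hζ : ζ.SmoothOn s) :
    Form.SmoothOn (η - ζ : Form n M k) s :=
  fun x hx => (hη x hx).sub (hζ x hx)

theorem Form.d_congr {W : Opens M} {ζ : Form n M k} (h : ∀ x ∈ W, η x = ζ x) {x : M}
    (hx : x ∈ W) : η.d x = ζ.d x := by
  simp only [Form.d, (inChart_congr h hx).extDeriv_eq]

theorem Form.d_sub {ζ : Form n M k} {s : Set M} (hη : η.SmoothOn s) (hζ : ζ.SmoothOn s) {x : M}
    (hx : x ∈ s) : Form.d (η - ζ : Form n M k) x = η.d x - ζ.d x := by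
  have : Form.inChart (η - ζ : Form n M k) x = η.inChart x + (-1 : ℝ) • ζ.inChart x := by
    rw [sub_eq_add_neg, inChart_add, inChart_neg]
    exact congrArg _ (neg_one_smul ℝ _).symm
  have h1 := (hη x hx).differentiableAt (by simp)
  have h2 := (hζ x hx).differentiableAt (by simp)
  simp only [Form.d]
  rw [this, extDeriv_add h1 (h2.const_smul _), extDeriv_smul, neg_one_smul, ← sub_eq_add_neg]
  rfl

theorem Form.d_zero (x : M) : Form.d (0 : Form n M k) x = 0 := by
  simp only [Form.d]
  rw [inChart_zero]
  have : extDeriv (0 : Model n → (Model n) [⋀^Fin k]→L[ℝ] ℝ) = 0 := by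
    funext e
    simpa [extDeriv] using
      (ContinuousAlternatingMap.alternatizeUncurryFinCLM ℝ (Model n) ℝ (n := k)).map_zero
  rw [this]
  rfl

variable [IsManifold (𝓡 (2 * n)) ∞ M]

/-- Smoothness of a form can be tested, and used, in any chart of the maximal atlas. -/
theorem Form.SmoothOn.contDiffAt_inC {s : Set M} (hη : η.SmoothOn s)
    (hφ : φ ∈ IsManifold.maximalAtlas (𝓡 (2 * n)) ∞ M) {e : Model n} (he : e ∈ φ.target)
    (hes : φ.symm e ∈ s) : ContDiffAt ℝ ∞ (η.inC φ) e :=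
  contDiffAt_inC_of_inC hφ (IsManifold.chart_mem_maximalAtlas _) he (mem_chart_source _ _)
    (hη _ hes)

/-- The expression in a chart of the exterior derivative is the exterior derivative of the
expression in this chart. -/
theorem Form.SmoothOn.inC_d {s : Set M} (hη : η.SmoothOn s)
    (hφ : φ ∈ IsManifold.maximalAtlas (𝓡 (2 * n)) ∞ M) {e : Model n} (he : e ∈ φ.target)
    (hes : φ.symm e ∈ s) : η.d.inC φ e = extDeriv (η.inC φ) e := by
  set x := φ.symm e with hx
  set ψ := chartAt (Model n) x with hψd
  have hψ : ψ ∈ IsManifold.maximalAtlas (𝓡 (2 * n)) ∞ M := IsManifold.chart_mem_maximalAtlas x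
  have he' : φ.symm e ∈ ψ.source := mem_chart_source _ x
  have ht := contDiffAt_transition hφ hψ he he'
  have hd : DifferentiableAt ℝ (η.inC ψ) ((ψ ∘ φ.symm) e) :=
    (hη x hes).differentiableAt (by simp)
  rw [(inC_eventuallyEq_pullback (η := η) hφ hψ he he').extDeriv_eq,
    extDeriv_pullback hd ht minSmoothness_two_le]
  ext v
  rw [inC_apply]
  refine congrArg (extDeriv (η.inC ψ) (ψ x)) (funext fun i => ?_)
  change tanTo ψ x (tanFrom φ e (v i)) = fderiv ℝ (ψ ∘ φ.symm) e (v i)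
  rw [tanFrom_eq_comp hφ hψ he he']
  have := tanTo_tanFrom hψ (ψ.map_source he') (fderiv ℝ (ψ ∘ φ.symm) e (v i))
  rwa [ψ.left_inv he'] at this

theorem Form.SmoothOn.d {W : Opens M} (hη : η.SmoothOn W) : η.d.SmoothOn W := by
  intro x hx
  have hφ : chartAt (Model n) x ∈ IsManifold.maximalAtlas (𝓡 (2 * n)) ∞ M :=
    IsManifold.chart_mem_maximalAtlas x
  have he := mem_chart_target (Model n) x
  have hinv : (chartAt (Model n) x).symm (chartAt (Model n) x x) = x :=
    (chartAt (Model n) x).left_inv (mem_chart_source _ x)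
  have h1 : η.d.inChart x =ᶠ[𝓝 (chartAt (Model n) x x)] extDeriv (η.inChart x) := by
    filter_upwards [eventually_mem_target_and_symm_mem he W.isOpen (by rw [hinv]; exact hx)] with y hy
    exact hη.inC_d hφ hy.1 hy.2
  refine ContDiffAt.congr_of_eventuallyEq ?_ h1
  exact (ContinuousAlternatingMap.alternatizeUncurryFinCLM ℝ (Model n) ℝ).contDiff.contDiffAt.comp _
    ((hη x hx).fderiv_right (m := ∞) (by simp))

theorem Form.SmoothOn.d_d {W : Opens M} (hη : η.SmoothOn W) {x : M} (hx : x ∈ W) :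
    η.d.d x = 0 := by
  have hφ : chartAt (Model n) x ∈ IsManifold.maximalAtlas (𝓡 (2 * n)) ∞ M :=
    IsManifold.chart_mem_maximalAtlas x
  have he := mem_chart_target (Model n) x
  have hinv : (chartAt (Model n) x).symm (chartAt (Model n) x x) = x :=
    (chartAt (Model n) x).left_inv (mem_chart_source _ x)
  have h1 : η.d.inChart x =ᶠ[𝓝 (chartAt (Model n) x x)] extDeriv (η.inChart x) := by
    filter_upwards [eventually_mem_target_and_symm_mem he W.isOpen (by rw [hinv]; exact hx)] with y hy
    exact hη.inC_d hφ hy.1 hy.2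
  rw [Form.d, h1.extDeriv_eq, extDeriv_extDeriv_apply (hη x hx) minSmoothness_two_le]
  rfl

end Pullback

end Charts

/-! ### Smoothness of the bihomogeneous parts of a form -/

section Parts

open TopologicalSpace Filter Bundle

variable {n : ℕ} {M : Type u} [TopologicalSpace M] [ChartedSpace (Model n) M]
  [IsManifold (𝓡 (2 * n)) ∞ M]

/-- The expression of a field of endomorphisms in a chart. -/
def endoInC (P : ∀ x : M, Tan n x →L[ℝ] Tan n x) (φ : OpenPartialHomeomorph M (Model n))
    (e : Model n) : Model n →L[ℝ] Model n :=
  (tanTo φ (φ.symm e)).comp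
    ((show Model n →L[ℝ] Model n from P (φ.symm e)).comp (tanFrom φ e))

theorem EndoSmooth.contDiffAt_endoInC {P : ∀ x : M, Tan n x →L[ℝ] Tan n x} (hP : EndoSmooth P)
    (x : M) : ContDiffAt ℝ ∞ (endoInC P (chartAt (Model n) x)) (chartAt (Model n) x x) := by
  set φ := chartAt (Model n) x with hφ
  have hinv : φ.symm (φ x) = x := φ.left_inv (mem_chart_source _ x)
  have hcore := ((contMDiffAt_hom_bundle _).1 (hP x)).2
  have hsymm : ContMDiffAt 𝓘(ℝ, Model n) (𝓡 (2 * n)) ∞ φ.symm (φ x) :=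
    contMDiffOn_chart_symm.contMDiffAt (φ.open_target.mem_nhds (mem_chart_target _ x))
  have hB : ContDiffAt ℝ ∞ (fun e => ContinuousLinearMap.inCoordinates (Model n)
      (TangentSpace (𝓡 (2 * n)) (M := M)) (Model n) (TangentSpace (𝓡 (2 * n)) (M := M)) x
      (φ.symm e) x (φ.symm e) (P (φ.symm e))) (φ x) := by
    rw [← contMDiffAt_iff_contDiffAt]
    exact ContMDiffAt.comp (φ x) (by rw [hinv]; exact hcore) hsymm
  refine hB.congr_of_eventuallyEq ?_
  filter_upwards [φ.open_target.mem_nhds (mem_chart_target _ x)] with e he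
  have hy : φ.symm e ∈ φ.source := φ.map_target he
  have hsy : (trivializationAt (Model n) (TangentSpace (𝓡 (2 * n))) x).symmL ℝ (φ.symm e) =
      mfderiv 𝓘(ℝ, Model n) (𝓡 (2 * n)) φ.symm e := by
    rw [TangentBundle.symmL_trivializationAt hy]
    simp only [mfld_simps, mfderivWithin_univ]
    let G : Model n → (Model n →L[ℝ] Model n) := fun e' =>
      mfderiv 𝓘(ℝ, Model n) (𝓡 (2 * n)) φ.symm e'
    exact congrArg G (φ.right_inv he)
  have hto : (trivializationAt (Model n) (TangentSpace (𝓡 (2 * n))) x).continuousLinearMapAt ℝ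
      (φ.symm e) = mfderiv (𝓡 (2 * n)) 𝓘(ℝ, Model n) φ (φ.symm e) := by
    rw [TangentBundle.continuousLinearMapAt_trivializationAt hy]
    simp only [mfld_simps]
    rfl
  rw [ContinuousLinearMap.inCoordinates, hsy, hto]
  rfl

theorem TangentStructure.NormalBundle.inC_part {S : TangentStructure n M} (N : S.NormalBundle)
    {φ : OpenPartialHomeomorph M (Model n)}
    (hφ : φ ∈ IsManifold.maximalAtlas (𝓡 (2 * n)) ∞ M) {k : ℕ} (p : ℕ) (η : Form n M k)
    {e : Model n} (he : e ∈ φ.target) :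
    (N.part p η).inC φ e = bidegreePart (ContinuousLinearMap.id ℝ (Model n) - endoInC N.proj φ e)
      (endoInC N.proj φ e) p (η.inC φ e) := by
  have key : ∀ w, tanFrom φ e (endoInC N.proj φ e w) =
      (show Model n →L[ℝ] Model n from N.proj (φ.symm e)) (tanFrom φ e w) := by
    intro w
    have := tanFrom_tanTo hφ (φ.map_target he)
      ((show Model n →L[ℝ] Model n from N.proj (φ.symm e)) (tanFrom φ e w))
    rwa [φ.right_inv he] at this
  ext v
  rw [bidegreePart_apply, Form.inC_apply]
  refine (bidegreePart_apply _ _ _ _ _).trans (Finset.sum_congr rfl fun A _ => ?_)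
  rw [Form.inC_apply]
  refine congrArg (η (φ.symm e)) (funext fun i => ?_)
  split_ifs
  · refine Eq.trans ?_ (map_sub (tanFrom φ e) (v i) (endoInC N.proj φ e (v i))).symm
    rw [key]
    rfl
  · exact (key _).symm

/-- The bihomogeneous parts of a smooth form are smooth. -/
theorem Form.SmoothOn.part {S : TangentStructure n M} (N : S.NormalBundle) {k : ℕ} (p : ℕ)
    {η : Form n M k} {s : Set M} (hη : η.SmoothOn s) : (N.part p η).SmoothOn s := by
  intro x hx
  have hP := N.smooth.contDiffAt_endoInC x
  have hQ : ContDiffAt ℝ ∞ (fun e => ContinuousLinearMap.id ℝ (Model n) -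
      endoInC N.proj (chartAt (Model n) x) e) (chartAt (Model n) x x) := contDiffAt_const.sub hP
  refine (contDiffAt_bidegreePart p (hη x hx) hQ hP).congr_of_eventuallyEq ?_
  filter_upwards [(chartAt (Model n) x).open_target.mem_nhds (mem_chart_target _ x)] with e he
  exact N.inC_part (IsManifold.chart_mem_maximalAtlas x) p η he

end Parts

/-! ### Calculus in charts adapted to the tangent structure -/

section AdaptedCharts

open TopologicalSpace Filter Bundle

variable {n : ℕ} {M : Type u} [TopologicalSpace M] [ChartedSpace (Model n) M]

theorem contDiffAt_comp_symm {φ : OpenPartialHomeomorph M (Model n)}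
    (hφ : φ ∈ IsManifold.maximalAtlas (𝓡 (2 * n)) ∞ M) {W : Opens M} {f : M → ℝ}
    (hf : ContMDiffOn (𝓡 (2 * n)) 𝓘(ℝ, ℝ) ∞ f W) {e : Model n} (he : e ∈ φ.target)
    (heW : φ.symm e ∈ W) : ContDiffAt ℝ ∞ (f ∘ φ.symm) e := by
  rw [← contMDiffAt_iff_contDiffAt]
  exact ContMDiffAt.comp e (hf.contMDiffAt (W.isOpen.mem_nhds heW))
    (contMDiffAt_symm_of_mem_maximalAtlas hφ he)

theorem diff_tanFrom {φ : OpenPartialHomeomorph M (Model n)}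
    (hφ : φ ∈ IsManifold.maximalAtlas (𝓡 (2 * n)) ∞ M) {f : M → ℝ} {e : Model n}
    (he : e ∈ φ.target) (hf : MDifferentiableAt (𝓡 (2 * n)) 𝓘(ℝ, ℝ) f (φ.symm e))
    (v : Model n) : diff f (φ.symm e) (tanFrom φ e v) = fderiv ℝ (f ∘ φ.symm) e v := by
  have h := mfderiv_comp e hf ((mdifferentiable_of_mem hφ).mdifferentiableAt_symm he)
  rw [mfderiv_eq_fderiv] at h
  rw [h]
  rfl

theorem Form.apply_eq_inC {φ : OpenPartialHomeomorph M (Model n)}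
    (hφ : φ ∈ IsManifold.maximalAtlas (𝓡 (2 * n)) ∞ M) {k : ℕ} (η : Form n M k) {x : M}
    (hx : x ∈ φ.source) (v : Fin k → Tan n x) :
    η x v = η.inC φ (φ x) (fun i => tanTo φ x (v i)) := by
  have h : ∀ y (_ : y = x) (b : Fin k → Model n),
      (show (Model n) [⋀^Fin k]→L[ℝ] ℝ from η y) b =
      (show (Model n) [⋀^Fin k]→L[ℝ] ℝ from η x) b := by
    rintro y rfl b; rfl
  rw [inC_apply]
  refine Eq.trans ?_ (h (φ.symm (φ x)) (φ.left_inv hx) _).symm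
  exact congrArg (η x) (funext fun i => (tanFrom_tanTo hφ hx (v i)).symm)

/-- The vector field with constant components `w` in the chart `φ`. -/
def constField (φ : OpenPartialHomeomorph M (Model n)) (w : Model n) (x : M) : Tan n x :=
  tanFrom φ (φ x) w

theorem constField_symm {φ : OpenPartialHomeomorph M (Model n)} {e : Model n} (he : e ∈ φ.target)
    (w : Model n) : constField φ w (φ.symm e) = tanFrom φ e w := by
  rw [constField, φ.right_inv he]

variable [IsManifold (𝓡 (2 * n)) ∞ M]

/-- The domain of a chart. -/
def chartDomain (φ : OpenPartialHomeomorph M (Model n)) : Opens M := ⟨φ.source, φ.open_source⟩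

theorem constField_smoothOn {φ : OpenPartialHomeomorph M (Model n)}
    (hφ : φ ∈ IsManifold.maximalAtlas (𝓡 (2 * n)) ∞ M) (w : Model n) :
    VFSmoothOn (constField φ w) (chartDomain φ : Set M) := by
  have h1 : ContMDiffOn 𝓘(ℝ, Model n).tangent (𝓡 (2 * n)).tangent ∞
      (tangentMapWithin 𝓘(ℝ, Model n) (𝓡 (2 * n)) φ.symm φ.target)
      (π (Model n) (TangentSpace 𝓘(ℝ, Model n)) ⁻¹' φ.target) :=
    (contMDiffOn_symm_of_mem_maximalAtlas hφ).contMDiffOn_tangentMapWithin (by simp)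
      φ.open_target.uniqueMDiffOn
  have h2 : ContMDiff 𝓘(ℝ, Model n) 𝓘(ℝ, Model n).tangent ∞
      (fun e : Model n => (⟨e, w⟩ : TangentBundle 𝓘(ℝ, Model n) (Model n))) := by
    intro e
    exact contMDiffAt_vectorSpace_iff_contDiffAt.2 contDiffAt_const
  have h3 : ContMDiffOn (𝓡 (2 * n)) 𝓘(ℝ, Model n).tangent ∞
      (fun x : M => (⟨φ x, w⟩ : TangentBundle 𝓘(ℝ, Model n) (Model n))) φ.source :=
    h2.comp_contMDiffOn (contMDiffOn_of_mem_maximalAtlas hφ)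
  refine (h1.comp h3 fun x hx => φ.map_source hx).congr fun x hx => ?_
  have key : ∀ y (_ : y = x) (v : Model n), (⟨x, v⟩ : TangentBundle (𝓡 (2 * n)) M) = ⟨y, v⟩ := by
    rintro y rfl v; rfl
  refine (key (φ.symm (φ x)) (φ.left_inv hx) _).trans ?_
  simp only [Function.comp_apply, tangentMapWithin]
  rw [mfderivWithin_of_isOpen φ.open_target (φ.map_source hx)]
  rfl

namespace TangentStructure

variable (S : TangentStructure n M)

/-- A chart `φ` is adapted to the tangent structure `S` if `S` is represented in it by a constant
endomorphism `S₀` of the model space, with `im S₀ = ker S₀`. -/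
structure Adapted (φ : OpenPartialHomeomorph M (Model n)) (S₀ : Model n →L[ℝ] Model n) :
    Prop where
  mem : φ ∈ IsManifold.maximalAtlas (𝓡 (2 * n)) ∞ M
  ker_iff : ∀ w, S₀ w = 0 ↔ ∃ u, S₀ u = w
  tanTo_endo : ∀ x ∈ φ.source, ∀ v : Tan n x, tanTo φ x (S.endo x v) = S₀ (tanTo φ x v)

theorem exists_adapted (x : M) : ∃ φ S₀, S.Adapted φ S₀ ∧ x ∈ φ.source := by
  obtain ⟨φ, hφ, hx, e, he⟩ := S.integrable x
  refine ⟨φ, (e.symm : _ →L[ℝ] Model n).comp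
    ((ContinuousLinearMap.inr ℝ (Fin n → ℝ) (Fin n → ℝ)).comp
      ((ContinuousLinearMap.fst ℝ (Fin n → ℝ) (Fin n → ℝ)).comp (e : Model n →L[ℝ] _))),
    ⟨hφ, fun w => ?_, fun z hz v => ?_⟩, hx⟩
  · constructor
    · intro hw
      have hw' : (e w).1 = 0 := by simpa using hw
      refine ⟨e.symm ((e w).2, 0), ?_⟩
      apply e.injective
      simp [Prod.ext_iff, hw']
    · rintro ⟨u, rfl⟩
      simp
  · apply e.injective
    refine (he z hz v).trans ?_
    simp only [tanTo, ContinuousLinearMap.comp_apply, ContinuousLinearMap.inr_apply]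
    exact (e.apply_symm_apply _).symm

variable {S}

namespace Adapted

variable {φ : OpenPartialHomeomorph M (Model n)} {S₀ : Model n →L[ℝ] Model n}
  (h : S.Adapted φ S₀)

include h

theorem sq (w : Model n) : S₀ (S₀ w) = 0 := (h.ker_iff _).2 ⟨w, rfl⟩

theorem endo_tanFrom {e : Model n} (he : e ∈ φ.target) (w : Model n) :
    S.endo (φ.symm e) (tanFrom φ e w) = tanFrom φ e (S₀ w) := by
  have h1 := h.tanTo_endo _ (φ.map_target he) (tanFrom φ e w)
  have h2 := tanFrom_tanTo h.mem (φ.map_target he) (S.endo (φ.symm e) (tanFrom φ e w))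
  rw [φ.right_inv he, h1] at h2
  rw [tanTo_tanFrom h.mem he] at h2
  exact h2.symm

theorem tanFrom_mem_vert {e : Model n} (he : e ∈ φ.target) (w : Model n) :
    tanFrom φ e (S₀ w) ∈ S.vert (φ.symm e) :=
  ⟨tanFrom φ e w, h.endo_tanFrom he w⟩

theorem exists_tanTo_eq {x : M} (hx : x ∈ φ.source) {v : Tan n x} (hv : v ∈ S.vert x) :
    ∃ w, S₀ w = tanTo φ x v := by
  obtain ⟨w, rfl⟩ := hv
  exact ⟨tanTo φ x w, (h.tanTo_endo x hx w).symm⟩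

/-- The expression of a derivative along a constant field. -/
theorem dirDeriv_constField_symm {f : M → ℝ} {e : Model n} (he : e ∈ φ.target)
    (hf : MDifferentiableAt (𝓡 (2 * n)) 𝓘(ℝ, ℝ) f (φ.symm e)) (w : Model n) :
    dirDeriv (constField φ w) f (φ.symm e) = fderiv ℝ (f ∘ φ.symm) e w := by
  rw [dirDeriv, constField_symm he, diff_tanFrom h.mem he hf]

theorem dirDeriv_app_constField_symm {f : M → ℝ} {e : Model n} (he : e ∈ φ.target)
    (hf : MDifferentiableAt (𝓡 (2 * n)) 𝓘(ℝ, ℝ) f (φ.symm e)) (w : Model n) :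
    dirDeriv (S.app (constField φ w)) f (φ.symm e) = fderiv ℝ (f ∘ φ.symm) e (S₀ w) := by
  rw [dirDeriv, app, constField_symm he, h.endo_tanFrom he, diff_tanFrom h.mem he hf]

/-- A smooth function is foliated if and only if its expression in an adapted chart has vanishing
derivatives in the vertical directions. -/
theorem foliatedFun_iff {W : Opens M} (hW : W ≤ chartDomain φ) {f : M → ℝ} :
    S.FoliatedFun W f ↔ ContMDiffOn (𝓡 (2 * n)) 𝓘(ℝ, ℝ) ∞ f W ∧
      ∀ e ∈ φ.target, φ.symm e ∈ W → ∀ w, fderiv ℝ (f ∘ φ.symm) e (S₀ w) = 0 := by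
  refine and_congr_right fun hf => ⟨fun h1 e he heW w => ?_, fun h1 x hx v hv => ?_⟩
  · rw [← diff_tanFrom h.mem he (mdiff_of_smoothOn hf heW)]
    exact h1 _ heW _ (h.tanFrom_mem_vert he w)
  · have hxs : x ∈ φ.source := hW hx
    have hinv := φ.left_inv hxs
    obtain ⟨w, hw⟩ := h.exists_tanTo_eq hxs hv
    have h2 := h1 (φ x) (φ.map_source hxs) (by rw [hinv]; exact hx) w
    rw [← diff_tanFrom h.mem (φ.map_source hxs)
      (by rw [hinv]; exact mdiff_of_smoothOn hf hx), hw] at h2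
    have key : ∀ y (_ : y = x) (b : Model n),
      (show Model n →L[ℝ] ℝ from diff f y) b = (show Model n →L[ℝ] ℝ from diff f x) b := by
      rintro y rfl b; rfl
    refine (congrArg (diff f x) (tanFrom_tanTo h.mem hxs v).symm).trans
      ((key (φ.symm (φ x)) hinv _).symm.trans h2)

/-- In an adapted chart, constant fields are foliated; they extend any given vector to a foliated
field. -/
theorem constField_foliated (a : Model n) : S.FoliatedField (chartDomain φ) (constField φ a) := by
  refine ⟨constField_smoothOn h.mem a, fun W hW f hf => ?_⟩
  have hs : ContMDiffOn (𝓡 (2 * n)) 𝓘(ℝ, ℝ) ∞ (dirDeriv (constField φ a) f) W :=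
    dirDeriv_smoothOn ((constField_smoothOn h.mem a).mono hW) hf.1
  refine (h.foliatedFun_iff hW).2 ⟨hs, fun e he heW w => ?_⟩
  have h1 : (dirDeriv (constField φ a) f ∘ φ.symm) =ᶠ[𝓝 e]
      fun y => fderiv ℝ (f ∘ φ.symm) y a := by
    filter_upwards [eventually_mem_target_and_symm_mem he W.isOpen heW] with y hy
    exact h.dirDeriv_constField_symm hy.1 (mdiff_of_smoothOn hf.1 hy.2) a
  have h2 : (fun y => fderiv ℝ (f ∘ φ.symm) y (S₀ w)) =ᶠ[𝓝 e] fun _ => 0 := by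
    filter_upwards [eventually_mem_target_and_symm_mem he W.isOpen heW] with y hy
    exact ((h.foliatedFun_iff hW).1 hf).2 y hy.1 hy.2 w
  have hc := contDiffAt_comp_symm h.mem hf.1 he heW
  have hd : DifferentiableAt ℝ (fderiv ℝ (f ∘ φ.symm)) e :=
    (hc.fderiv_right (m := ∞) (by simp)).differentiableAt (by simp)
  have hsymm : IsSymmSndFDerivAt ℝ (f ∘ φ.symm) e :=
    hc.isSymmSndFDerivAt minSmoothness_two_le
  have e1 : ∀ b c, fderiv ℝ (fun y => fderiv ℝ (f ∘ φ.symm) y b) e c =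
      fderiv ℝ (fderiv ℝ (f ∘ φ.symm)) e c b := by
    intro b c
    rw [fderiv_clm_apply hd (differentiableAt_const b)]
    simp
  -- by symmetry of second derivatives, the vertical derivative can be taken first
  rw [h1.fderiv_eq, e1, hsymm.eq, ← e1, h2.fderiv_eq]
  simp

end Adapted

end TangentStructure

end AdaptedCharts

/-! ### Forms of type `(1, 0)` and their differentials -/

section LocalComputations

open TopologicalSpace Filter Bundle

variable {n : ℕ} {M : Type u} [TopologicalSpace M] [ChartedSpace (Model n) M]

theorem contMDiffOn_of_contDiffAt_comp_symm {φ : OpenPartialHomeomorph M (Model n)}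
    (hφ : φ ∈ IsManifold.maximalAtlas (𝓡 (2 * n)) ∞ M) {W : Opens M} (hW : (W : Set M) ⊆ φ.source)
    {f : M → ℝ} (hf : ∀ e ∈ φ.target, φ.symm e ∈ W → ContDiffAt ℝ ∞ (f ∘ φ.symm) e) :
    ContMDiffOn (𝓡 (2 * n)) 𝓘(ℝ, ℝ) ∞ f W := by
  intro x hx
  have hxs := hW hx
  have h1 := contMDiffAt_iff_contDiffAt.2
    (hf (φ x) (φ.map_source hxs) (by rw [φ.left_inv hxs]; exact hx))
  have h2 := (ContMDiffAt.comp x h1 (contMDiffAt_of_mem_maximalAtlas hφ hxs)).congr_of_eventuallyEq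
    (f₁ := f) (by
      filter_upwards [φ.open_source.mem_nhds hxs] with y hy
      simp [φ.left_inv hy])
  exact h2.contMDiffWithinAt

theorem fderiv_one_form_apply {ξ : Model n → (Model n) [⋀^Fin 1]→L[ℝ] ℝ} {X : Model n → Model n}
    {e : Model n} (hξ : DifferentiableAt ℝ ξ e) (hX : DifferentiableAt ℝ X e) (v : Model n) :
    fderiv ℝ (fun y => ξ y (fun _ => X y)) e v =
      fderiv ℝ (fun y => ξ y (fun _ => X e)) e v + ξ e (fun _ => fderiv ℝ X e v) := by
  let T := (ContinuousAlternatingMap.ofSubsingletonLIE (𝕜 := ℝ) (E := Model n) (F := ℝ)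
    (0 : Fin 1)).symm
  have hT : ∀ (y u : Model n), ξ y (fun _ => u) = T (ξ y) u := fun _ _ => rfl
  have hB : DifferentiableAt ℝ (fun y => T (ξ y)) e := T.differentiableAt.comp e hξ
  simp only [hT]
  rw [fderiv_clm_apply hB hX, fderiv_clm_apply hB (differentiableAt_const (X e))]
  simp [add_comm]

/-- The expression of a vector field in a chart. -/
def fieldInC (X : ∀ x : M, Tan n x) (φ : OpenPartialHomeomorph M (Model n)) (e : Model n) :
    Model n :=
  tanTo φ (φ.symm e) (X (φ.symm e))

theorem dirDeriv_comp_chart {φ : OpenPartialHomeomorph M (Model n)}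
    (hφ : φ ∈ IsManifold.maximalAtlas (𝓡 (2 * n)) ∞ M) (X : ∀ x : M, Tan n x)
    (l : Model n →L[ℝ] ℝ) {x : M} (hx : x ∈ φ.source) :
    dirDeriv X (l ∘ φ) x = l (tanTo φ x (X x)) := by
  have h1 : HasMFDerivAt 𝓘(ℝ, Model n) 𝓘(ℝ, ℝ) l (φ x) l := l.hasMFDerivAt
  have h2 := ((mdifferentiable_of_mem hφ).mdifferentiableAt hx).hasMFDerivAt
  rw [dirDeriv, diff, (HasMFDerivAt.comp x h1 h2).mfderiv]
  rfl

variable [IsManifold (𝓡 (2 * n)) ∞ M]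

theorem Form.SmoothOn.d_one_inC {ξ : Form n M 1} {s : Set M} (hξ : ξ.SmoothOn s)
    {φ : OpenPartialHomeomorph M (Model n)}
    (hφ : φ ∈ IsManifold.maximalAtlas (𝓡 (2 * n)) ∞ M) {e : Model n} (he : e ∈ φ.target)
    (hes : φ.symm e ∈ s) (a b : Model n) :
    ξ.d (φ.symm e) ![tanFrom φ e a, tanFrom φ e b] =
      fderiv ℝ (fun y => ξ.inC φ y (fun _ => b)) e a -
        fderiv ℝ (fun y => ξ.inC φ y (fun _ => a)) e b := by
  rw [← extDeriv_one_apply ((hξ.contDiffAt_inC hφ he hes).differentiableAt (by simp)),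
    ← hξ.inC_d hφ he hes, Form.inC_apply]
  refine congrArg (ξ.d (φ.symm e)) (funext fun i => ?_)
  fin_cases i <;> rfl

namespace TangentStructure

variable {S : TangentStructure n M}

/-- If a form vanishes when one of its arguments is vertical, then its exterior derivative
vanishes when two of its arguments are vertical: this is where the integrability of the vertical
distribution enters. -/
theorem d_apply_eq_zero_of_vert {k : ℕ} {η : Form n M k} {W : Opens M} (hη : η.SmoothOn W)
    (h0 : ∀ y ∈ W, ∀ (v : Fin k → Tan n y) (i : Fin k), v i ∈ S.vert y → η y v = 0)
    {x : M} (hx : x ∈ W) {v : Fin (k + 1) → Tan n x} {i j : Fin (k + 1)} (hij : i ≠ j)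
    (hi : v i ∈ S.vert x) (hj : v j ∈ S.vert x) : η.d x v = 0 := by
  obtain ⟨φ, S₀, h, hxs⟩ := S.exists_adapted x
  have he := φ.map_source hxs
  have heW : φ.symm (φ x) ∈ W := by rw [φ.left_inv hxs]; exact hx
  rw [Form.apply_eq_inC h.mem _ hxs, hη.inC_d h.mem he heW]
  refine extDeriv_apply_eq_zero (V := Set.range S₀)
    ((hη.contDiffAt_inC h.mem he heW).differentiableAt (by simp)) ?_ hij
    (h.exists_tanTo_eq hxs hi) (h.exists_tanTo_eq hxs hj)
  filter_upwards [eventually_mem_target_and_symm_mem he W.isOpen heW] with y hy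
  rintro u l ⟨w, hw⟩
  refine h0 _ hy.2 (fun i => tanFrom φ y (u i)) l ?_
  have := h.tanFrom_mem_vert hy.1 w
  rwa [hw] at this

theorem theta_apply (L : M → ℝ) (x : M) (v : Fin 1 → Tan n x) :
    S.theta L x v = diff L x (S.endo x (v 0)) := rfl

theorem theta_apply_eq_zero (L : M → ℝ) (x : M) (v : Fin 1 → Tan n x) (i : Fin 1)
    (hv : v i ∈ S.vert x) : S.theta L x v = 0 := by
  obtain ⟨w, hw⟩ := hv
  have hw' : S.endo x w = v 0 := by rw [Subsingleton.elim 0 i]; exact hw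
  rw [theta_apply, ← hw', S.sq_eq_zero, map_zero]

/-- In terms of the Hessian `g` of `L`, one has `dθ_L (u, S w) = - g (u, w)`. -/
theorem d_theta_apply {L : M → ℝ} {U : Opens M}
    (hL : ContMDiffOn (𝓡 (2 * n)) 𝓘(ℝ, ℝ) ∞ L U)
    {g : ∀ x : M, Tan n x →L[ℝ] Tan n x →L[ℝ] ℝ} (hg : S.IsHessian L U g) {x : M} (hx : x ∈ U)
    (u w : Tan n x) : (S.theta L).d x ![u, S.endo x w] = -g x u w := by
  obtain ⟨φ, S₀, h, hxs⟩ := S.exists_adapted x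
  obtain ⟨e, he, rfl⟩ : ∃ e ∈ φ.target, φ.symm e = x := ⟨φ x, φ.map_source hxs, φ.left_inv hxs⟩
  obtain ⟨a, rfl⟩ : ∃ a, tanFrom φ e a = u := ⟨tanTo φ (φ.symm e) u, by
    have := tanFrom_tanTo h.mem hxs u; rwa [φ.right_inv he] at this⟩
  obtain ⟨b, rfl⟩ : ∃ a, tanFrom φ e a = w := ⟨tanTo φ (φ.symm e) w, by
    have := tanFrom_tanTo h.mem hxs w; rwa [φ.right_inv he] at this⟩
  have hev := eventually_mem_target_and_symm_mem he U.isOpen hx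
  have hθ : ∀ c, (fun y => (S.theta L).inC φ y (fun _ => c)) =ᶠ[𝓝 e]
      fun y => fderiv ℝ (L ∘ φ.symm) y (S₀ c) := by
    intro c
    filter_upwards [hev] with y hy
    change diff L (φ.symm y) (S.endo (φ.symm y) (tanFrom φ y c)) = _
    rw [h.endo_tanFrom hy.1, diff_tanFrom h.mem hy.1 (mdiff_of_smoothOn hL hy.2)]
  rw [h.endo_tanFrom he, (theta_smoothOn S hL).d_one_inC h.mem he hx, (hθ _).fderiv_eq,
    (hθ _).fderiv_eq, h.sq]
  -- the Hessian is evaluated on the constant extension of the first argument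
  have hgx := hg (U ⊓ chartDomain φ) inf_le_left (constField φ a)
    ⟨(h.constField_foliated a).1.mono (fun y hy => hy.2),
      fun W' hW' => (h.constField_foliated a).2 W' (hW'.trans inf_le_right)⟩
    (φ.symm e) ⟨hx, hxs⟩ (tanFrom φ e b)
  have hsX : VFSmoothOn (S.app (constField φ a)) (U ⊓ chartDomain φ : Opens M) :=
    S.app_smoothOn ((h.constField_foliated a).1.mono (fun y hy => hy.2))
  have hs : ContMDiffOn (𝓡 (2 * n)) 𝓘(ℝ, ℝ) ∞ (dirDeriv (S.app (constField φ a)) L)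
      (U ⊓ chartDomain φ : Opens M) :=
    dirDeriv_smoothOn hsX (hL.mono (fun y hy => hy.1))
  rw [constField_symm he, h.endo_tanFrom he, diff_tanFrom h.mem he
    (mdiff_of_smoothOn hs ⟨hx, hxs⟩)] at hgx
  have hdd : (dirDeriv (S.app (constField φ a)) L ∘ φ.symm) =ᶠ[𝓝 e]
      fun y => fderiv ℝ (L ∘ φ.symm) y (S₀ a) := by
    filter_upwards [hev] with y hy
    exact h.dirDeriv_app_constField_symm hy.1 (mdiff_of_smoothOn hL hy.2) a
  rw [hgx, hdd.fderiv_eq]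
  simp

theorem FoliatedFun.of_local {W : Opens M} {f : M → ℝ}
    (h : ∀ x ∈ W, ∃ W' : Opens M, x ∈ W' ∧ S.FoliatedFun W' f) : S.FoliatedFun W f := by
  refine ⟨fun x hx => ?_, fun x hx => ?_⟩
  · obtain ⟨W', hx', hf⟩ := h x hx
    exact (hf.1.contMDiffAt (W'.isOpen.mem_nhds hx')).contMDiffWithinAt
  · obtain ⟨W', hx', hf⟩ := h x hx
    exact hf.2 x hx'

theorem FoliatedField.mono {W W' : Opens M} {X : ∀ x : M, Tan n x} (hX : S.FoliatedField W X)
    (h : W' ≤ W) : S.FoliatedField W' X :=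
  ⟨ContMDiffOn.mono hX.1 h, fun W'' hW => hX.2 W'' (hW.trans h)⟩

/-- A foliated 1-form of type `(1, 0)` is annihilated by `d''`. -/
theorem FoliatedOneForm.d_apply {W : Opens M} {ξ : Form n M 1} (hξ : S.FoliatedOneForm W ξ)
    {x : M} (hx : x ∈ W) (u : Tan n x) {v : Tan n x} (hv : v ∈ S.vert x) :
    ξ.d x ![u, v] = 0 := by
  obtain ⟨w, rfl⟩ := hv
  change ξ.d x ![u, S.endo x w] = 0
  obtain ⟨φ, S₀, h, hxs⟩ := S.exists_adapted x
  obtain ⟨e, he, rfl⟩ : ∃ e ∈ φ.target, φ.symm e = x := ⟨φ x, φ.map_source hxs, φ.left_inv hxs⟩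
  obtain ⟨a, rfl⟩ : ∃ a, tanFrom φ e a = u := ⟨tanTo φ (φ.symm e) u, by
    have := tanFrom_tanTo h.mem hxs u; rwa [φ.right_inv he] at this⟩
  obtain ⟨b, rfl⟩ : ∃ a, tanFrom φ e a = w := ⟨tanTo φ (φ.symm e) w, by
    have := tanFrom_tanTo h.mem hxs w; rwa [φ.right_inv he] at this⟩
  have hev := eventually_mem_target_and_symm_mem he W.isOpen hx
  rw [h.endo_tanFrom he, hξ.1.d_one_inC h.mem he hx]
  have h1 : (fun y => ξ.inC φ y (fun _ => S₀ b)) =ᶠ[𝓝 e] fun _ => 0 := by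
    filter_upwards [hev] with y hy
    exact hξ.2.1 _ hy.2 _ (h.tanFrom_mem_vert hy.1 b)
  have h2 := ((h.foliatedFun_iff (W := W ⊓ chartDomain φ) inf_le_right).1
    (hξ.2.2 (W ⊓ chartDomain φ) inf_le_left (constField φ a)
      ((h.constField_foliated a).mono inf_le_right))).2 e he ⟨hx, hxs⟩ b
  have h3 : (fun y => ξ.inC φ y (fun _ => a)) =ᶠ[𝓝 e]
      (fun x => ξ x (fun _ => constField φ a x)) ∘ φ.symm := by
    filter_upwards [hev] with y hy
    rw [Form.inC_apply, Function.comp_apply, constField_symm hy.1]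
  rw [h1.fderiv_eq, h3.fderiv_eq, h2]
  simp

theorem contDiffAt_comp_fieldInC {φ : OpenPartialHomeomorph M (Model n)}
    (hφ : φ ∈ IsManifold.maximalAtlas (𝓡 (2 * n)) ∞ M) {X : ∀ x : M, Tan n x} {W : Opens M}
    (hX : VFSmoothOn X (W : Set M)) (hW : W ≤ chartDomain φ) (l : Model n →L[ℝ] ℝ) {e : Model n}
    (he : e ∈ φ.target) (heW : φ.symm e ∈ W) : ContDiffAt ℝ ∞ (fun y => l (fieldInC X φ y)) e := by
  have hl : ContMDiffOn (𝓡 (2 * n)) 𝓘(ℝ, ℝ) ∞ (l ∘ φ) W :=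
    (l.contMDiff.comp_contMDiffOn (contMDiffOn_of_mem_maximalAtlas hφ)).mono hW
  refine (contDiffAt_comp_symm hφ (dirDeriv_smoothOn hX hl) he heW).congr_of_eventuallyEq ?_
  filter_upwards [eventually_mem_target_and_symm_mem he W.isOpen heW] with y hy
  exact (dirDeriv_comp_chart hφ X l (φ.map_target hy.1)).symm

theorem contDiffAt_fieldInC {φ : OpenPartialHomeomorph M (Model n)}
    (hφ : φ ∈ IsManifold.maximalAtlas (𝓡 (2 * n)) ∞ M) {X : ∀ x : M, Tan n x} {W : Opens M}
    (hX : VFSmoothOn X (W : Set M)) (hW : W ≤ chartDomain φ) {e : Model n} (he : e ∈ φ.target)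
    (heW : φ.symm e ∈ W) : ContDiffAt ℝ ∞ (fieldInC X φ) e :=
  contDiffAt_euclidean.2 fun i =>
    contDiffAt_comp_fieldInC hφ hX hW (EuclideanSpace.proj i) he heW

/-- The components of a foliated field transversal to the leaves are constant along the leaves. -/
theorem Adapted.endo_fderiv_fieldInC {φ : OpenPartialHomeomorph M (Model n)}
    {S₀ : Model n →L[ℝ] Model n} (h : S.Adapted φ S₀) {X : ∀ x : M, Tan n x} {W : Opens M}
    (hX : S.FoliatedField W X) (hW : W ≤ chartDomain φ) {e : Model n} (he : e ∈ φ.target)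
    (heW : φ.symm e ∈ W) (w : Model n) : S₀ (fderiv ℝ (fieldInC X φ) e (S₀ w)) = 0 := by
  ext i
  -- the functions `l ∘ φ`, where `l` runs through the components of `S₀`, are foliated
  let l : Model n →L[ℝ] ℝ := (EuclideanSpace.proj i).comp S₀
  have hl : ContMDiffOn (𝓡 (2 * n)) 𝓘(ℝ, ℝ) ∞ (l ∘ φ) W :=
    (l.contMDiff.comp_contMDiffOn (contMDiffOn_of_mem_maximalAtlas h.mem)).mono hW
  have hlf : S.FoliatedFun W (l ∘ φ) := by
    refine (h.foliatedFun_iff hW).2 ⟨hl, fun y hy _ u => ?_⟩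
    have h1 : (l ∘ φ) ∘ φ.symm =ᶠ[𝓝 y] l := by
      filter_upwards [φ.open_target.mem_nhds hy] with z hz
      simp [φ.right_inv hz]
    rw [h1.fderiv_eq, l.fderiv]
    simp [l, h.sq]
  have h2 := ((h.foliatedFun_iff hW).1 (hX.2 W le_rfl _ hlf)).2 e he heW w
  have h3 : dirDeriv X (l ∘ φ) ∘ φ.symm =ᶠ[𝓝 e] fun y => l (fieldInC X φ y) := by
    filter_upwards [eventually_mem_target_and_symm_mem he W.isOpen heW] with y hy
    exact dirDeriv_comp_chart h.mem X l (φ.map_target hy.1)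
  have hd := (contDiffAt_fieldInC h.mem hX.1 hW he heW).differentiableAt (by simp)
  have h4 : fderiv ℝ (fun y => l (fieldInC X φ y)) e = l.comp (fderiv ℝ (fieldInC X φ) e) :=
    (l.hasFDerivAt.comp e hd.hasFDerivAt).fderiv
  rw [h3.fderiv_eq, h4] at h2
  exact h2

/-- A 1-form of type `(1, 0)` that is annihilated by `d''` is foliated. -/
theorem foliatedOneForm_of_d {W : Opens M} {ξ : Form n M 1} (hξ : ξ.SmoothOn W)
    (hv : ∀ x ∈ W, ∀ v ∈ S.vert x, ξ x (fun _ => v) = 0)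
    (hd : ∀ x ∈ W, ∀ u : Tan n x, ∀ v ∈ S.vert x, ξ.d x ![u, v] = 0) :
    S.FoliatedOneForm W ξ := by
  refine ⟨hξ, hv, fun W₁ hW₁ X hX => FoliatedFun.of_local fun x hx => ?_⟩
  obtain ⟨φ, S₀, h, hxs⟩ := S.exists_adapted x
  refine ⟨W₁ ⊓ chartDomain φ, ⟨hx, hxs⟩, ?_⟩
  set W₂ := W₁ ⊓ chartDomain φ
  have hX₂ : S.FoliatedField W₂ X := hX.mono inf_le_left
  have hW₂ : W₂ ≤ chartDomain φ := inf_le_right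
  have hW₂' : W₂ ≤ W := inf_le_left.trans hW₁
  have hloc : ∀ e ∈ φ.target, φ.symm e ∈ W₂ → ((fun x => ξ x (fun _ => X x)) ∘ φ.symm) =ᶠ[𝓝 e]
      fun y => ξ.inC φ y (fun _ => fieldInC X φ y) := by
    intro e he heW
    filter_upwards [eventually_mem_target_and_symm_mem he W₂.isOpen heW] with y hy
    rw [Form.inC_apply]
    refine congrArg (ξ (φ.symm y)) (funext fun _ => ?_)
    have := tanFrom_tanTo h.mem (φ.map_target hy.1) (X (φ.symm y))
    rw [φ.right_inv hy.1] at this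
    exact this.symm
  refine (h.foliatedFun_iff hW₂).2 ⟨contMDiffOn_of_contDiffAt_comp_symm h.mem hW₂
    fun e he heW => ?_, fun e he heW w => ?_⟩
  · exact (contDiffAt_alternating_apply (g := fun _ => fieldInC X φ)
      (hξ.contDiffAt_inC h.mem he (hW₂' heW))
      fun _ => contDiffAt_fieldInC h.mem hX₂.1 hW₂ he heW).congr_of_eventuallyEq (hloc e he heW)
  · have hξd := (hξ.contDiffAt_inC h.mem he (hW₂' heW)).differentiableAt (by simp)
    have hXd := (contDiffAt_fieldInC h.mem hX₂.1 hW₂ he heW).differentiableAt (by simp)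
    rw [(hloc e he heW).fderiv_eq, fderiv_one_form_apply hξd hXd]
    obtain ⟨u, hu⟩ := (h.ker_iff _).1 (h.endo_fderiv_fieldInC hX₂ hW₂ he heW w)
    have h1 : ξ.inC φ e (fun _ => fderiv ℝ (fieldInC X φ) e (S₀ w)) = 0 := by
      rw [← hu]
      exact hv _ (hW₂' heW) _ (h.tanFrom_mem_vert he u)
    have h2 : (fun y => ξ.inC φ y (fun _ => S₀ w)) =ᶠ[𝓝 e] fun _ => 0 := by
      filter_upwards [eventually_mem_target_and_symm_mem he W₂.isOpen heW] with y hy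
      exact hv _ (hW₂' hy.2) _ (h.tanFrom_mem_vert hy.1 w)
    have h3 := hξ.d_one_inC h.mem he (hW₂' heW) (fieldInC X φ e) (S₀ w)
    -- `ξ` vanishes on the constant vertical vector `S₀ w`, so `dξ = 0` only leaves one term
    have h4 := h3.symm.trans (hd _ (hW₂' heW) _ _ (h.tanFrom_mem_vert he w))
    rw [h2.fderiv_eq] at h4
    rw [h1, add_zero]
    simpa using h4

end TangentStructure

end LocalComputations

/-! ### The bigrading in low degrees -/

section LowDegrees

variable {n : ℕ} {M : Type u} [TopologicalSpace M] [ChartedSpace (Model n) M]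

theorem Form.apply_swap (η : Form n M 2) (x : M) (u v : Tan n x) :
    η x ![u, v] = -η x ![v, u] := by
  have h := (η x).toAlternatingMap.map_swap ![v, u] (i := 0) (j := 1) (by decide)
  have h2 : ![v, u] ∘ Equiv.swap (0 : Fin 2) 1 = ![u, v] := by
    funext i
    fin_cases i <;> simp
  rw [h2] at h
  exact h

theorem Form.ext_two {η ζ : Form n M 2} {x : M}
    (h : ∀ u v : Tan n x, η x ![u, v] = ζ x ![u, v]) : η x = ζ x := by
  ext v
  have hv : v = ![v 0, v 1] := by
    funext i
    fin_cases i <;> rfl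
  rw [hv]
  exact h _ _

theorem Form.apply_zero_left (η : Form n M 2) (x : M) (v : Tan n x) : η x ![0, v] = 0 :=
  (η x).map_coord_zero 0 rfl

theorem Form.apply_zero_right (η : Form n M 2) (x : M) (u : Tan n x) : η x ![u, 0] = 0 :=
  (η x).map_coord_zero 1 rfl

variable [IsManifold (𝓡 (2 * n)) ∞ M]

namespace TangentStructure.NormalBundle

variable {S : TangentStructure n M} (N : S.NormalBundle)

theorem proj_mem_vert (x : M) (v : Tan n x) : N.proj x v ∈ S.vert x := by
  obtain ⟨a, ha, b, hb, rfl⟩ := Submodule.mem_sup.1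
    ((N.isCompl x).sup_eq_top ▸ Submodule.mem_top : v ∈ N.N x ⊔ S.vert x)
  rwa [map_add, N.proj_normal x a ha, N.proj_vert x b hb, zero_add]

theorem proj_proj (x : M) (v : Tan n x) : N.proj x (N.proj x v) = N.proj x v :=
  N.proj_vert x _ (N.proj_mem_vert x v)

theorem part_apply {k : ℕ} (p : ℕ) (η : Form n M k) (x : M) (v : Fin k → Tan n x) :
    N.part p η x v = ∑ A ∈ Finset.powersetCard p (Finset.univ : Finset (Fin k)),
      η x (fun i => if i ∈ A then v i - N.proj x (v i) else N.proj x (v i)) := by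
  refine (bidegreePart_apply _ _ _ _ _).trans (Finset.sum_congr rfl fun A _ => ?_)
  refine congrArg (η x) (funext fun i => ?_)
  split_ifs <;> rfl

theorem part_congr {k : ℕ} (p : ℕ) {η ζ : Form n M k} {x : M} (h : η x = ζ x) :
    N.part p η x = N.part p ζ x := by
  simp only [part, h]

theorem part_eq_zero {k : ℕ} (p : ℕ) {η : Form n M k} {x : M} (h : η x = 0) :
    N.part p η x = 0 := by
  ext v
  rw [part_apply, h]
  simp

theorem part_zero_one_apply (η : Form n M 1) (x : M) (v : Fin 1 → Tan n x) :
    N.part 0 η x v = η x (fun i => N.proj x (v i)) := by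
  simp [part_apply]

theorem part_one_one_apply (η : Form n M 1) (x : M) (v : Fin 1 → Tan n x) :
    N.part 1 η x v = η x (fun i => v i - N.proj x (v i)) := by
  have : Finset.powersetCard 1 (Finset.univ : Finset (Fin 1)) = {Finset.univ} := by decide
  rw [part_apply, this, Finset.sum_singleton]
  exact congrArg (η x) (funext fun i => if_pos (Finset.mem_univ i))

theorem part_zero_two_apply (η : Form n M 2) (x : M) (u v : Tan n x) :
    N.part 0 η x ![u, v] = η x ![N.proj x u, N.proj x v] := by
  simp only [part_apply, Finset.powersetCard_zero, Finset.sum_singleton]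
  refine congrArg (η x) (funext fun i => ?_)
  fin_cases i <;> rfl

theorem part_one_two_apply (η : Form n M 2) (x : M) (u v : Tan n x) :
    N.part 1 η x ![u, v] =
      η x ![u - N.proj x u, N.proj x v] + η x ![N.proj x u, v - N.proj x v] := by
  have : Finset.powersetCard 1 (Finset.univ : Finset (Fin 2)) = {{0}, {1}} := by decide
  rw [part_apply, this, Finset.sum_pair (by decide)]
  refine congrArg₂ (· + ·) (congrArg (η x) (funext fun i => ?_))
    (congrArg (η x) (funext fun i => ?_)) <;>
  · fin_cases i <;> rfl

theorem part_two_two_apply (η : Form n M 2) (x : M) (u v : Tan n x) :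
    N.part 2 η x ![u, v] = η x ![u - N.proj x u, v - N.proj x v] := by
  have : Finset.powersetCard 2 (Finset.univ : Finset (Fin 2)) = {Finset.univ} := by decide
  rw [part_apply, this, Finset.sum_singleton]
  refine congrArg (η x) (funext fun i => ?_)
  fin_cases i <;> rfl

/-- The component of type `(1, 2)` of a 3-form only involves its values on triples with two vertical
vectors. -/
theorem part_one_three_eq_zero {η : Form n M 3} {x : M}
    (h : ∀ (v : Fin 3 → Tan n x) (i j : Fin 3), i ≠ j → v i ∈ S.vert x → v j ∈ S.vert x →
      η x v = 0) : N.part 1 η x = 0 := by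
  ext v
  rw [part_apply]
  refine Finset.sum_eq_zero fun A hA => ?_
  obtain ⟨i, j, hij, hi, hj⟩ : ∃ i j : Fin 3, i ≠ j ∧ i ∉ A ∧ j ∉ A := by
    revert A
    decide
  refine h _ i j hij ?_ ?_
  · simpa [hi] using N.proj_mem_vert x (v i)
  · simpa [hj] using N.proj_mem_vert x (v j)

theorem part_one_part_one (η : Form n M 2) : N.part 1 (N.part 1 η) = N.part 1 η := by
  funext x
  refine Form.ext_two fun u v => ?_
  simp [part_one_two_apply, proj_proj, Form.apply_zero_left, Form.apply_zero_right]

theorem part_one_part_zero (η : Form n M 2) : N.part 1 (N.part 0 η) = 0 := by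
  funext x
  refine Form.ext_two fun u v => ?_
  rw [part_one_two_apply, part_zero_two_apply, part_zero_two_apply]
  simp [proj_proj, Form.apply_zero_left, Form.apply_zero_right]

theorem part_zero_part_one (η : Form n M 2) : N.part 0 (N.part 1 η) = 0 := by
  funext x
  refine Form.ext_two fun u v => ?_
  rw [part_zero_two_apply, part_one_two_apply]
  simp [proj_proj, Form.apply_zero_left, Form.apply_zero_right]

theorem part_two_part_one (η : Form n M 2) : N.part 2 (N.part 1 η) = 0 := by
  funext x
  refine Form.ext_two fun u v => ?_
  rw [part_two_two_apply, part_one_two_apply]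
  simp [proj_proj, Form.apply_zero_left, Form.apply_zero_right]

/-- A 2-form without component of type `(0, 2)` agrees with its component of type `(1, 1)` as soon as
the second argument is vertical. -/
theorem part_one_apply_of_vert {η : Form n M 2} {x : M}
    (h : ∀ u ∈ S.vert x, ∀ v ∈ S.vert x, η x ![u, v] = 0) (u : Tan n x) {v : Tan n x}
    (hv : v ∈ S.vert x) : N.part 1 η x ![u, v] = η x ![u, v] := by
  rw [part_one_two_apply, N.proj_vert x v hv, sub_self, Form.apply_zero_right, add_zero]
  have h1 : η x ![u - N.proj x u, v] = η x ![u, v] - η x ![N.proj x u, v] := by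
    simp
  rw [h1, h _ (N.proj_mem_vert x u) v hv, sub_zero]

theorem part_one_eq_of_vert {η ζ : Form n M 2} {x : M}
    (h : ∀ (u : Tan n x), ∀ v ∈ S.vert x, η x ![u, v] = ζ x ![u, v]) :
    N.part 1 η x = N.part 1 ζ x := by
  refine Form.ext_two fun u v => ?_
  rw [part_one_two_apply, part_one_two_apply, h _ _ (N.proj_mem_vert x v),
    Form.apply_swap η x (N.proj x u), Form.apply_swap ζ x (N.proj x u),
    h _ _ (N.proj_mem_vert x u)]

section OneForms

variable {η : Form n M 1} (h : ∀ x, ∀ v ∈ S.vert x, η x (fun _ => v) = 0)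

include h

theorem part_zero_eq_zero : N.part 0 η = 0 := by
  funext x
  ext v
  rw [part_zero_one_apply]
  have : (fun i => N.proj x (v i)) = fun _ => N.proj x (v 0) := by
    funext i
    rw [Subsingleton.elim i 0]
  rw [this]
  exact h x _ (N.proj_mem_vert x _)

theorem part_one_eq_self : N.part 1 η = η := by
  funext x
  ext v
  rw [part_one_one_apply]
  have h1 : ∀ a : Fin 1 → Tan n x, a = fun _ => a 0 := by
    intro a
    funext i
    rw [Subsingleton.elim i 0]
  have h2 : η x (fun i => v i - N.proj x (v i)) = η x v - η x (fun _ => N.proj x (v 0)) := by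
    have := (η x).map_update_sub v 0 (v 0) (N.proj x (v 0))
    rw [h1 (Function.update v 0 (v 0 - N.proj x (v 0))), h1 (Function.update v 0 (v 0)),
      h1 (Function.update v 0 (N.proj x (v 0)))] at this
    simp only [Function.update_self] at this
    rw [h1 (fun i => v i - N.proj x (v i)), h1 v]
    exact this
  rw [h2, h x _ (N.proj_mem_vert x _), sub_zero]

/-- On 1-forms of type `(1, 0)`, the operator `d''` is the component of type `(1, 1)` of the exterior
derivative. -/
theorem dpp_one : N.dpp η = N.part 1 η.d := by
  have h0 : Form.d (0 : Form n M 1) = 0 := funext Form.d_zero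
  have h1 : N.part 0 (0 : Form n M 2) = 0 := funext fun x => N.part_eq_zero 0 rfl
  rw [dpp, Finset.sum_range_succ, Finset.sum_range_one, N.part_zero_eq_zero h,
    N.part_one_eq_self h, h0, h1, zero_add]

end OneForms

theorem part_one_one_apply_vert (μ : Form n M 1) (x : M) {v : Tan n x} (hv : v ∈ S.vert x) :
    N.part 1 μ x (fun _ => v) = 0 := by
  rw [part_one_one_apply]
  refine (μ x).map_coord_zero 0 ?_
  rw [N.proj_vert x v hv, sub_self]

/-- The component of type `(1, 1)` of `d''μ` only involves the component of type `(1, 0)` of `μ`. -/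
theorem part_one_dpp (μ : Form n M 1) : N.part 1 (N.dpp μ) = N.part 1 (N.part 1 μ).d := by
  have hadd : ∀ η ζ : Form n M 2, N.part 1 (η + ζ : Form n M 2) = N.part 1 η + N.part 1 ζ := by
    intro η ζ
    funext x
    refine Form.ext_two fun u v => ?_
    change _ = N.part 1 η x ![u, v] + N.part 1 ζ x ![u, v]
    rw [part_one_two_apply, part_one_two_apply, part_one_two_apply]
    change (η x _ + ζ x _) + (η x _ + ζ x _) = _
    ring
  rw [dpp, Finset.sum_range_succ, Finset.sum_range_one, hadd, part_one_part_zero,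
    part_one_part_one, zero_add]

/-- On 2-forms of type `(1, 1)`, the operator `d''` is the component of type `(1, 2)` of the exterior
derivative. -/
theorem dpp_two {η : Form n M 2} (h : N.part 1 η = η) : N.dpp η = N.part 1 η.d := by
  have h0 : Form.d (0 : Form n M 2) = 0 := funext Form.d_zero
  have h1 : ∀ p, N.part p (0 : Form n M 3) = 0 := fun p => funext fun x => N.part_eq_zero p rfl
  have h2 : N.part 0 η = 0 := by rw [← h, part_zero_part_one]
  have h3 : N.part 2 η = 0 := by rw [← h, part_two_part_one]
  rw [dpp, Finset.sum_range_succ, Finset.sum_range_succ, Finset.sum_range_one, h2, h3, h, h0,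
    h1, h1, zero_add, add_zero]

end TangentStructure.NormalBundle

end LowDegrees

/-! ### Vanishing of Čech classes -/

section CechVanishing

open CategoryTheory Opposite TopologicalSpace

variable {X : Type u} [TopologicalSpace X]

/-- Point-indexed coverings are directed: two of them are refined by the pointwise intersection. -/
instance : IsDirectedOrder (PointCover X) where
  directed U V := ⟨⟨fun x => U.1 x ⊓ V.1 x, fun x => ⟨U.2 x, V.2 x⟩⟩,
    fun _ => inf_le_left, fun _ => inf_le_right⟩

instance (F : AbPresheaf X) : DirectedSystem (fun U : PointCover X => CoverH1 F U.1)
    (fun _ _ h => refineH1 F id h) where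
  map_self U c := by
    induction c using QuotientAddGroup.induction_on with
    | H c =>
      refine congrArg (QuotientAddGroup.mk (s := (delta0 F U.1).range)) (Subtype.ext ?_)
      funext i j
      exact congrArg (fun f => f.hom (c.1 i j)) (F.map_id _)
  map_map W V U h k c := by
    induction c using QuotientAddGroup.induction_on with
    | H c =>
      change (QuotientAddGroup.mk (refineZ1 F id k (refineZ1 F id h c)) : CoverH1 F W.1) =
        QuotientAddGroup.mk (refineZ1 F id (h.trans k) c)
      refine congrArg (QuotientAddGroup.mk (s := (delta0 F W.1).range)) (Subtype.ext ?_)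
      funext i j
      exact res_res F _ _ _

open Classical in
/-- The class of a cocycle of a point-indexed covering vanishes if and only if the cocycle becomes a
coboundary on a finer covering. -/
theorem ofPointCover_mk_eq_zero_iff (F : AbPresheaf X) (U : PointCover X) (c : Z1 F U.1) :
    ofPointCover F U (QuotientAddGroup.mk c) = 0 ↔
      ∃ (V : PointCover X) (h : ∀ x, V.1 x ≤ U.1 x) (b : ∀ x, F.obj (op (V.1 x))),
        ∀ x y, res F (inf_le_inf (h x) (h y)) (c.1 x y) =
          res F inf_le_right (b y) - res F inf_le_left (b x) := by
  constructor
  · intro h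
    obtain ⟨V, hV, h0⟩ := AddCommGroup.DirectLimit.of.zero_exact _ _ h
    have h1 : (QuotientAddGroup.mk (refineZ1 F id hV c) : CoverH1 F V.1) = 0 := h0
    obtain ⟨b, hb⟩ := (QuotientAddGroup.eq_zero_iff _).1 h1
    refine ⟨V, hV, b, fun x y => ?_⟩
    exact (congrFun (congrFun (congrArg Subtype.val hb) x) y).symm
  · rintro ⟨V, hV, b, hb⟩
    have h1 : (QuotientAddGroup.mk (refineZ1 F id hV c) : CoverH1 F V.1) = 0 :=
      (QuotientAddGroup.eq_zero_iff _).2 ⟨b, Subtype.ext (funext fun x => funext fun y =>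
        (hb x y).symm)⟩
    have h2 : ofPointCover F V (refineH1 F id hV (QuotientAddGroup.mk c)) =
        ofPointCover F U (QuotientAddGroup.mk c) :=
      AddCommGroup.DirectLimit.of_f (G := fun U : PointCover X => CoverH1 F U.1)
        (f := fun _ _ h => refineH1 F id h) (i := U) (j := V) hV (QuotientAddGroup.mk c)
    rw [← h2]
    refine Eq.trans (congrArg _ ?_) (map_zero _)
    exact h1

open Classical in
/-- The value of `mapH1` on a class that comes from a given covering. -/
theorem mapH1_ofPointCover {F G : AbPresheaf X} (η : F ⟶ G) (U : PointCover X)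
    (c : CoverH1 F U.1) :
    mapH1 η (ofPointCover F U c) = ofPointCover G U (mapCoverH1 η U.1 c) :=
  AddCommGroup.DirectLimit.map_apply_of _ _ _

end CechVanishing

namespace TangentStructure.LocallyLagrange

open CategoryTheory Opposite TopologicalSpace

variable {n : ℕ} {M : Type u} [TopologicalSpace M] [ChartedSpace (Model n) M]
  [IsManifold (𝓡 (2 * n)) ∞ M] {S : TangentStructure n M} {ι : Type w} (Λ : S.LocallyLagrange ι)

/-- The index of a chosen member of the covering that contains `x`. -/
def index (x : M) : ι := (Λ.cover x).choose

theorem mem_index (x : M) : x ∈ Λ.U (Λ.index x) := (Λ.cover x).choose_spec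

/-- The point-indexed covering made of the chosen members of the covering. -/
def pointCover : PointCover M := ⟨fun x => Λ.U (Λ.index x), Λ.mem_index⟩

theorem theta_sub {L L' : M → ℝ} {W : Opens M} (hL : ContMDiffOn (𝓡 (2 * n)) 𝓘(ℝ, ℝ) ∞ L W)
    (hL' : ContMDiffOn (𝓡 (2 * n)) 𝓘(ℝ, ℝ) ∞ L' W) {x : M} (hx : x ∈ W) :
    S.theta (L - L') x = S.theta L x - S.theta L' x := by
  have h : diff (n := n) (L - L') x = diff L x - diff L' x := by
    have hneg : ContMDiffOn (𝓡 (2 * n)) 𝓘(ℝ, ℝ) ∞ (-L') W := hL'.neg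
    rw [sub_eq_add_neg, diff_add hL hneg hx, diff_neg, ← sub_eq_add_neg]
  ext v
  change diff (L - L') x _ = diff L x _ - diff L' x _
  rw [h]
  rfl

/-- The first Lagrangian obstruction vanishes if and only if, on some refinement of the covering,
the cocycle `θ_{L β} - θ_{L α}` is the coboundary of a cochain of foliated forms. -/
theorem firstObstruction_eq_zero_iff : Λ.firstObstruction = 0 ↔
    ∃ (V : PointCover M) (_ : ∀ x, V.1 x ≤ Λ.U (Λ.index x)) (b : M → Form n M 1),
      (∀ x, S.FoliatedOneForm (V.1 x) (b x)) ∧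
      ∀ x y, ∀ z ∈ V.1 x ⊓ V.1 y,
        S.theta (Λ.L (Λ.index y)) z - S.theta (Λ.L (Λ.index x)) z = b y z - b x z := by
  have h0 : Λ.firstObstruction = ofPointCover S.sheafOmega Λ.pointCover
      (QuotientAddGroup.mk (mapZ1 S.piPrime Λ.pointCover.1
        (refineZ1 S.sheafA Λ.index (fun _ => le_rfl) Λ.cocycle))) :=
    mapH1_ofPointCover S.piPrime Λ.pointCover _
  have hval : ∀ x y z (hz : z ∈ Λ.U (Λ.index x) ⊓ Λ.U (Λ.index y)),
      ((mapZ1 S.piPrime Λ.pointCover.1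
        (refineZ1 S.sheafA Λ.index (fun _ => le_rfl) Λ.cocycle)).1 x y :
          S.foliatedFormClass.sections _).1 ⟨z, hz⟩ =
      S.theta (Λ.L (Λ.index y)) z - S.theta (Λ.L (Λ.index x)) z := by
    intro x y z hz
    rw [← theta_sub (W := Λ.U (Λ.index x) ⊓ Λ.U (Λ.index y))
      ((Λ.smooth_L _).mono fun a ha => ha.2) ((Λ.smooth_L _).mono fun a ha => ha.1) hz]
    change S.theta (extZero _ _) z = _
    have : diff (n := n) (extZero (Λ.U (Λ.index x) ⊓ Λ.U (Λ.index y))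
        (fun a : (Λ.U (Λ.index x) ⊓ Λ.U (Λ.index y) : Opens M) =>
          (Λ.L (Λ.index y) - Λ.L (Λ.index x)) a)) z =
        diff (Λ.L (Λ.index y) - Λ.L (Λ.index x)) z :=
      diff_congr_on (fun a ha => extZero_apply _ ha) hz
    exact congrArg (fun d : Tan n z →L[ℝ] ℝ =>
      ContinuousAlternatingMap.ofSubsingleton ℝ (Tan n z) ℝ (0 : Fin 1) (d.comp (S.endo z))) this
  rw [h0, ofPointCover_mk_eq_zero_iff]
  constructor
  · rintro ⟨V, hV, b, hb⟩
    let E : M → Type := fun x => (Tan n x) [⋀^Fin 1]→L[ℝ] ℝ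
    let s : ∀ x, S.foliatedFormClass.sections (V.1 x) := b
    refine ⟨V, hV, fun x => extZero (E := E) (V.1 x) (s x).1, fun x => (s x).2,
      fun x y z hz => ?_⟩
    have e₁ : extZero (E := E) (V.1 x) (s x).1 z = (s x).1 ⟨z, hz.1⟩ :=
      extZero_apply (E := E) (s x).1 hz.1
    have e₂ : extZero (E := E) (V.1 y) (s y).1 z = (s y).1 ⟨z, hz.2⟩ :=
      extZero_apply (E := E) (s y).1 hz.2
    refine (hval x y z ⟨hV x hz.1, hV y hz.2⟩).symm.trans ?_
    refine (congrFun (congrArg Subtype.val (hb x y)) ⟨z, hz⟩).trans ?_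
    exact (congrArg₂ (fun a c : (Tan n z) [⋀^Fin 1]→L[ℝ] ℝ => a - c) e₂ e₁).symm
  · rintro ⟨V, hV, b, hb, hbc⟩
    refine ⟨V, hV, fun x => S.foliatedFormClass.toSection (V.1 x) (b x) (hb x), fun x y => ?_⟩
    apply Subtype.ext
    funext z
    exact (hval x y z.1 ⟨hV x z.2.1, hV y z.2.2⟩).trans (hbc x y z.1 z.2)

end TangentStructure.LocallyLagrange

/-! ### The form `Θ` -/

namespace TangentStructure.LocallyLagrange

open TopologicalSpace

variable {n : ℕ} {M : Type u} [TopologicalSpace M] [ChartedSpace (Model n) M]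
  [IsManifold (𝓡 (2 * n)) ∞ M] {S : TangentStructure n M} {ι : Type w} (Λ : S.LocallyLagrange ι)
  (N : S.NormalBundle)

theorem dpp_theta (L : M → ℝ) : N.dpp (S.theta L) = N.part 1 (S.theta L).d :=
  N.dpp_one fun x v hv => theta_apply_eq_zero L x (fun _ => v) 0 hv

theorem d_theta_apply_eq_zero (α : ι) {x : M} (hx : x ∈ Λ.U α) {u v : Tan n x}
    (hu : u ∈ S.vert x) (hv : v ∈ S.vert x) : (S.theta (Λ.L α)).d x ![u, v] = 0 :=
  d_apply_eq_zero_of_vert (theta_smoothOn S (Λ.smooth_L α))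
    (fun y _ w i hw => theta_apply_eq_zero _ y w i hw) hx (i := 0) (j := 1) (by decide) hu hv

/-- The metric determines `d''θ_{L α}`: this formula does not involve the Lagrangian. -/
theorem dpp_theta_apply (α : ι) {x : M} (hx : x ∈ Λ.U α) {u v u' v' : Tan n x}
    (hu : S.endo x u' = N.proj x u) (hv : S.endo x v' = N.proj x v) :
    N.dpp (S.theta (Λ.L α)) x ![u, v] = Λ.g x v u' - Λ.g x u v' := by
  have hg : ∀ a b, Λ.g x (a - N.proj x a) b = Λ.g x a b := by
    intro a b
    rw [map_sub, sub_apply, Λ.transversal x _ b (N.proj_mem_vert x a), sub_zero]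
  rw [dpp_theta, N.part_one_two_apply, Form.apply_swap _ x (N.proj x u), ← hu, ← hv,
    d_theta_apply (Λ.smooth_L α) (Λ.hessian α) hx, d_theta_apply (Λ.smooth_L α) (Λ.hessian α) hx,
    hu, hv, hg, hg]
  ring

/-- The forms `d''θ_{L α}` agree on the intersections. -/
theorem dpp_theta_eq (α β : ι) {x : M} (hα : x ∈ Λ.U α) (hβ : x ∈ Λ.U β) :
    N.dpp (S.theta (Λ.L α)) x = N.dpp (S.theta (Λ.L β)) x := by
  refine Form.ext_two fun u v => ?_
  obtain ⟨u', hu⟩ := N.proj_mem_vert x u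
  obtain ⟨v', hv⟩ := N.proj_mem_vert x v
  rw [Λ.dpp_theta_apply N α hα hu hv, Λ.dpp_theta_apply N β hβ hu hv]

/-- The global form `Θ` glued from the forms `d''θ_{L α}`. -/
def Theta : Form n M 2 := fun x => N.dpp (S.theta (Λ.L (Λ.index x))) x

theorem Theta_eq (α : ι) {x : M} (hx : x ∈ Λ.U α) :
    Λ.Theta N x = N.dpp (S.theta (Λ.L α)) x :=
  Λ.dpp_theta_eq N _ α (Λ.mem_index x) hx

/-- On pairs with a vertical vector, `Θ` agrees with the exact form `dθ_{L α}`. -/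
theorem Theta_apply_of_vert (α : ι) {x : M} (hx : x ∈ Λ.U α) (u : Tan n x) {v : Tan n x}
    (hv : v ∈ S.vert x) : Λ.Theta N x ![u, v] = (S.theta (Λ.L α)).d x ![u, v] := by
  rw [Λ.Theta_eq N α hx, dpp_theta]
  exact N.part_one_apply_of_vert (fun _ ha _ hb => Λ.d_theta_apply_eq_zero α hx ha hb) u hv

theorem Theta_smooth : (Λ.Theta N).Smooth := by
  intro x _
  have h : Form.SmoothOn (N.part 1 (S.theta (Λ.L (Λ.index x))).d) (Λ.U (Λ.index x)) :=
    Form.SmoothOn.part N 1 (theta_smoothOn S (Λ.smooth_L _)).d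
  refine h.congr (fun y hy => ?_) x (Λ.mem_index x)
  rw [Λ.Theta_eq N _ hy, dpp_theta]

theorem Theta_nondegenerate : (Λ.Theta N).Nondegenerate := by
  have key : ∀ (x : M) (v w : Tan n x), Λ.Theta N x ![v, S.endo x w] = -Λ.g x v w := by
    intro x v w
    have hw : S.endo x w ∈ S.vert x := ⟨w, rfl⟩
    rw [Λ.Theta_apply_of_vert N _ (Λ.mem_index x) v hw]
    exact d_theta_apply (Λ.smooth_L _) (Λ.hessian _) (Λ.mem_index x) v w
  intro x v hv
  have h1 : v ∈ S.vert x := Λ.nondegenerate x v fun w => by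
    rw [← neg_eq_zero, ← key, hv]
  obtain ⟨z, rfl⟩ := h1
  have h2 : z ∈ S.vert x := Λ.nondegenerate x z fun w => by
    have h3 := key x w z
    rw [Form.apply_swap] at h3
    rw [Λ.symm, ← neg_eq_zero, ← h3, neg_eq_zero]
    exact hv w
  obtain ⟨z', rfl⟩ := h2
  exact S.sq_eq_zero x z'

theorem part_one_Theta : N.part 1 (Λ.Theta N) = Λ.Theta N := by
  funext x
  have h := Λ.Theta_eq N _ (Λ.mem_index x)
  rw [dpp_theta] at h
  rw [h, N.part_congr 1 h, N.part_one_part_one]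

/-- `Θ` and `dθ_{L α}` differ by a form of type `(2, 0)`, whose differential has no component of
type `(1, 2)` because the vertical distribution is integrable. -/
theorem dpp_Theta : N.dpp (Λ.Theta N) = 0 := by
  rw [N.dpp_two (Λ.part_one_Theta N)]
  funext x
  refine N.part_one_three_eq_zero fun v i j hij hi hj => ?_
  set α := Λ.index x
  have hx : x ∈ Λ.U α := Λ.mem_index x
  have hθ : (S.theta (Λ.L α)).SmoothOn (Λ.U α) := theta_smoothOn S (Λ.smooth_L α)
  have hΘ : (Λ.Theta N).SmoothOn (Λ.U α) := (Λ.Theta_smooth N).mono (Set.subset_univ _)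
  have h0 : ∀ y ∈ Λ.U α, ∀ (w : Fin 2 → Tan n y) (l : Fin 2), w l ∈ S.vert y →
      (Λ.Theta N - (S.theta (Λ.L α)).d : Form n M 2) y w = 0 := by
    intro y hy w l hw
    have hww : w = ![w 0, w 1] := by
      funext l
      fin_cases l <;> rfl
    have hr : ∀ a b, b ∈ S.vert y →
        (Λ.Theta N - (S.theta (Λ.L α)).d : Form n M 2) y ![a, b] = 0 := fun a b hb =>
      sub_eq_zero.2 (Λ.Theta_apply_of_vert N α hy a hb)
    rw [hww]
    fin_cases l
    · rw [Form.apply_swap, hr (w 1) (w 0) hw, neg_zero]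
    · exact hr (w 0) (w 1) hw
  have h1 := d_apply_eq_zero_of_vert (hΘ.sub hθ.d) h0 hx hij hi hj
  rw [Form.d_sub hΘ hθ.d hx, hθ.d_d hx, sub_zero] at h1
  exact h1

theorem dppExact_of_firstObstruction (h : Λ.firstObstruction = 0) : N.DppExact (Λ.Theta N) := by
  obtain ⟨V, hV, b, hb, hbc⟩ := Λ.firstObstruction_eq_zero_iff.1 h
  -- the forms `θ_{L α} - b_α` agree on intersections; `μ` is at `x` the one attached to `x`
  let μ : Form n M 1 := fun x => S.theta (Λ.L (Λ.index x)) x - b x x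
  have hμ : ∀ x, ∀ y ∈ V.1 x, (S.theta (Λ.L (Λ.index x)) - b x : Form n M 1) y = μ y := by
    intro x y hy
    have h1 := hbc x y y ⟨hy, V.2 y⟩
    change S.theta (Λ.L (Λ.index x)) y - b x y = S.theta (Λ.L (Λ.index y)) y - b y y
    rw [sub_eq_sub_iff_sub_eq_sub, ← neg_sub, h1, neg_sub]
  have hθ : ∀ x, (S.theta (Λ.L (Λ.index x))).SmoothOn (V.1 x) := fun x =>
    (theta_smoothOn S (Λ.smooth_L _)).mono (hV x)
  have hvert : ∀ x, ∀ v ∈ S.vert x, μ x (fun _ => v) = 0 := by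
    intro x v hv
    change S.theta (Λ.L (Λ.index x)) x (fun _ => v) - b x x (fun _ => v) = 0
    rw [theta_apply_eq_zero _ x _ 0 hv, (hb x).2.1 x (V.2 x) v hv, sub_zero]
  refine ⟨μ, fun x _ => (((hθ x).sub (hb x).1).congr (hμ x)) x (V.2 x), ?_⟩
  rw [N.dpp_one hvert]
  funext x
  have h1 : μ.d x = (S.theta (Λ.L (Λ.index x))).d x - (b x).d x := by
    rw [← Form.d_congr (hμ x) (V.2 x), Form.d_sub (hθ x) (hb x).1 (V.2 x)]
  rw [Λ.Theta_eq N _ (Λ.mem_index x), dpp_theta]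
  refine N.part_one_eq_of_vert fun u v hv => ?_
  rw [h1]
  change (S.theta (Λ.L (Λ.index x))).d x ![u, v] - (b x).d x ![u, v] = _
  rw [(hb x).d_apply (V.2 x) u hv, sub_zero]

theorem firstObstruction_of_dppExact (h : N.DppExact (Λ.Theta N)) : Λ.firstObstruction = 0 := by
  obtain ⟨μ, hμ, hμΘ⟩ := h
  set μ' := N.part 1 μ with hμ'
  have hs : μ'.Smooth := Form.SmoothOn.part N 1 hμ
  have hvert : ∀ x, ∀ v ∈ S.vert x, μ' x (fun _ => v) = 0 := fun x v hv =>
    N.part_one_one_apply_vert μ x hv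
  have hΘ : Λ.Theta N = N.part 1 μ'.d := by
    rw [← N.part_one_dpp μ, hμΘ, part_one_Theta]
  refine Λ.firstObstruction_eq_zero_iff.2 ⟨Λ.pointCover, fun _ => le_rfl,
    fun x => S.theta (Λ.L (Λ.index x)) - μ', fun x => ?_, fun x y z _ => ?_⟩
  · have hθ : (S.theta (Λ.L (Λ.index x))).SmoothOn (Λ.U (Λ.index x)) :=
      theta_smoothOn S (Λ.smooth_L _)
    have hsx : μ'.SmoothOn (Λ.U (Λ.index x)) := hs.mono (Set.subset_univ _)
    refine foliatedOneForm_of_d (hθ.sub hsx) (fun y _ v hv => ?_) fun y hy u v hv => ?_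
    · change S.theta (Λ.L (Λ.index x)) y (fun _ => v) - μ' y (fun _ => v) = 0
      rw [theta_apply_eq_zero _ y _ 0 hv, hvert y v hv, sub_zero]
    · rw [Form.d_sub hθ hsx hy]
      change (S.theta (Λ.L (Λ.index x))).d y ![u, v] - μ'.d y ![u, v] = 0
      have hv2 : ∀ a ∈ S.vert y, ∀ c ∈ S.vert y, μ'.d y ![a, c] = 0 := fun a ha c hc =>
        d_apply_eq_zero_of_vert hsx (fun z _ w i hw => by
          have : w = fun _ => w i := funext fun j => by rw [Subsingleton.elim j i]
          rw [this]
          exact hvert z _ hw) hy (i := 0) (j := 1) (by decide) ha hc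
      rw [← Λ.Theta_apply_of_vert N _ hy u hv, hΘ, N.part_one_apply_of_vert hv2 u hv, sub_self]
  · change _ = (S.theta (Λ.L (Λ.index y)) z - μ' z) - (S.theta (Λ.L (Λ.index x)) z - μ' z)
    rw [sub_sub_sub_cancel_right]

end TangentStructure.LocallyLagrange

end

end LocLagrange

/-- On a locally Lagrange space, every choice of a normal bundle of the vertical foliation yields a
global 2-form `Θ`, obtained by gluing the forms `d''θ_{L α}`; it is of type `(1, 1)`, it is an almost
symplectic structure and it is `d''`-closed, and it is `d''`-exact if and only if the first
Lagrangian obstruction vanishes. -/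
theorem proposition2p4 {n : ℕ} {M : Type*} [TopologicalSpace M]
    [ChartedSpace (LocLagrange.Model n) M] [IsManifold (𝓡 (2 * n)) ∞ M]
    (S : LocLagrange.TangentStructure n M) {ι : Type*} (Λ : S.LocallyLagrange ι)
    (N : S.NormalBundle) :
    ∃ Θ : LocLagrange.Form n M 2,
      (∀ α, ∀ x ∈ Λ.U α, Θ x = N.dpp (S.theta (Λ.L α)) x) ∧
      LocLagrange.IsAlmostSymplectic Θ ∧
      N.IsOfType 1 1 Θ ∧
      N.dpp Θ = 0 ∧
      (Λ.firstObstruction = 0 ↔ N.DppExact Θ) :=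
  ⟨Λ.Theta N, fun α _ hx => Λ.Theta_eq N α hx, ⟨Λ.Theta_smooth N, Λ.Theta_nondegenerate N⟩,
    ⟨rfl, Λ.part_one_Theta N⟩, Λ.dpp_Theta N,
    ⟨Λ.dppExact_of_firstObstruction N, Λ.firstObstruction_of_dppExact N⟩⟩
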